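/- Let $r(0),r(1),r(2),\dots$ be integers with $r(0)=1$ and $r(m)\le r(m+1)\le r(m)+1$ for all $m\ge 0$. Candidates $1,2,\dots$ with i.i.d. values $X_1,X_2,\dots$ having a continuous distribution are examined in order. If $m$ candidates have been accepted so far, the next candidate is accepted if $r(m)=m+1$, or if $r(m)\le m$ and her value is above the $r(m)$-th largest of the values already accepted. Let $M_n$ be the number of accepted candidates among the first $n$. Suppose that there are integers $q,\nu$ with $1\le \nu\le q$ such that $r(m+q)=r(m)+\nu$ for all $m\ge 1$, and let $\alpha:=\nu/q$. Let $W$ be the almost sure limit of $M_n/n^{\alpha}$; this limit exists, and it has the same distribution as $$e^{(\alpha-1)\gamma-\alpha\rho-\alpha}\,e^{-\alpha Z},\qquad \rho:=\sum_{m=1}^\infty\Bigl(\frac1{r(m)}-\frac1{\alpha m}\Bigr),\qquad Z:=\sum_{k=1}^\infty\frac{\delta_k}{r(k)}(E_k-1),$$ where $\gamma$ is Euler's constant, $\delta_k:=1$ if $r(k)=r(k-1)$ and $\delta_k:=0$ otherwise, and $E_1,E_2,\dots$ are i.i.d. exponential random variables with mean $1$ (the series for $\rho$ converges absolutely, the series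 for $Z$ converges almost surely). Then, for every real $s\ge 0$, $\mathbb E W^s<\infty$ and, as $n\to\infty$, $$\begin{aligned} \frac{\mathbb E M_n^s}{n^{\alpha s}}\to \mathbb E W^s &=\frac{\Gamma(s+1)}{\Gamma(s\alpha+2)}\prod_{i=1}^q\frac{\Gamma(\frac iq)\,\Gamma(\frac sq+\frac{r(i)}\nu)}{\Gamma(\frac{r(i)}\nu)\,\Gamma(\frac sq+\frac iq)}\\ &=\frac{q^s}{\Gamma(s\alpha+2)}\prod_{i=1}^q\frac{\Gamma(\frac sq+\frac{r(i)}\nu)}{\Gamma(\frac{r(i)}\nu)}\\ &=\frac{q^s}{\nu^{\alpha s}}\prod_{i=1}^q\frac{\Gamma(\frac sq+\frac{r(i)}\nu)}{\Gamma(\frac{r(i)}\nu)}\prod_{j=2}^{\nu+1}\frac{\Gamma(\frac j\nu)}{\Gamma(\frac sq+\frac j\nu)}\\ &=\frac{q^{s+1}}{\nu^{\alpha s}(\nu s+q)}\prod_{i=1}^q\frac{\Gamma(\frac sq+\frac{r(i)}\nu)}{\Gamma(\frac{r(i)}\nu)}\prod_{j=1}^{\nu}\frac{\Gamma(\frac j\nu)}{\Gamma(\frac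 sq+\frac j\nu)}. \end{aligned}$$ -/

import Mathlib

open Filter Topology MeasureTheory ProbabilityTheory

namespace Hiring

noncomputable section

/-- A rank threshold sequence: `r(0) = 1` and `r(m) ≤ r(m+1) ≤ r(m) + 1` for all `m ≥ 0`. -/
def IsRankThreshold (r : ℕ → ℕ) : Prop :=
  r 0 = 1 ∧ ∀ m, r m ≤ r (m + 1) ∧ r (m + 1) ≤ r m + 1

/-- The `k`-th best (i.e. `k`-th largest) value in the multiset `s`, for `1 ≤ k ≤ card s`
(the value `0` returned for other `k` is never used). -/
def kthBest (s : Multiset ℝ) (k : ℕ) : ℝ :=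
  (s.sort (fun a b => a ≥ b)).getD (k - 1) 0

/-- Given the multiset `s` of the values accepted so far, with `m = card s`, the next candidate,
having value `x`, is accepted if `r(m) = m + 1`, or if `x` is above the `r(m)`-th best of the
accepted values. -/
def Accepts (r : ℕ → ℕ) (s : Multiset ℝ) (x : ℝ) : Prop :=
  r s.card = s.card + 1 ∨ kthBest s (r s.card) < x

open Classical in
/-- The multiset of accepted values among candidates `1, …, n`, candidate `i` having
value `x i` (`x 0` is not used). -/
def acceptedValues (r : ℕ → ℕ) (x : ℕ → ℝ) : ℕ → Multiset ℝ
  | 0 => 0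
  | n + 1 =>
    if Accepts r (acceptedValues r x n) (x (n + 1)) then
      x (n + 1) ::ₘ acceptedValues r x n
    else acceptedValues r x n

/-- `M_n`, the number of accepted candidates among candidates `1, …, n`. -/
def numAccepted (r : ℕ → ℕ) (x : ℕ → ℝ) (n : ℕ) : ℕ :=
  (acceptedValues r x n).card

/-- `δ_k = 1` if `r(k) = r(k-1)` and `δ_k = 0` otherwise (used for `k ≥ 1`). -/
def delta (r : ℕ → ℕ) (k : ℕ) : ℝ :=
  if r k = r (k - 1) then 1 else 0

/-- The partial sum `∑_{k=1}^m (δ_k / r(k)) (e_k - 1)`. -/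
def partialZ (r : ℕ → ℕ) (e : ℕ → ℝ) (m : ℕ) : ℝ :=
  ∑ k ∈ Finset.Icc 1 m, delta r k / r k * (e k - 1)

/-- `Z = ∑_{k=1}^∞ (δ_k / r(k)) (e_k - 1)`, as the limit of the partial sums (the series is
only conditionally convergent in general). -/
def seriesZ (r : ℕ → ℕ) (e : ℕ → ℝ) : ℝ :=
  limUnder atTop (partialZ r e)

/-- `ρ = ∑_{m=1}^∞ (1 / r(m) - 1 / (α m))`. -/
def rho (r : ℕ → ℕ) (α : ℝ) : ℝ :=
  ∑' m : ℕ, (1 / (r (m + 1) : ℝ) - 1 / (α * ((m + 1 : ℕ) : ℝ)))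

/-- `W = exp((α - 1) γ - α ρ - α) exp(- α Z)`, with `γ` Euler's constant. -/
def limitW (r : ℕ → ℕ) (α : ℝ) (e : ℕ → ℝ) : ℝ :=
  Real.exp ((α - 1) * Real.eulerMascheroniConstant - α * rho r α - α) *
    Real.exp (-α * seriesZ r e)

end

end Hiring

namespace Hiring

noncomputable section

/-! Acceptance of candidate `n+1` depends only on `M_n` and on her rank among all the first `n+1`
candidates (`accepts_acceptedValues_iff`): a value good enough to be accepted now has never seen a
better candidate rejected. By exchangeability that rank is uniform given the past of `M`, so `M` is
a Markov chain that goes from `m` to `m+1` at time `n+1` with probability `r(m)/(n+1)`.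

For such a chain the product `b_t(m) = ∏_{k<m} (1 + t/r(k))` satisfies `E b_t(M_n) = ∏_{k=1}^n (1 +
t/k) ~ n^t / Γ(t+1)` (`integral_birthProd`). Periodicity gives `b_t(m) ~ C_t m^(t/α)` with `C_t` a
ratio of Gamma values (`tendsto_birthProd`). The case `t = 1` is a positive martingale after
division by `n+1`, whence the almost sure limit `W` of `M_n/n^α`. With `t = αs`, comparison of the
two growth rates gives `C_t E W^s = 1/Γ(αs+1)`; limit and expectation are exchanged through the
bound on the moment of order `2s`, which is available as soon as `2αs > -1`.

For the representation of `W`, the moments of the explicit variable are limits of products of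
exponential Laplace transforms, and the factorization `birthProd_eq_mul` identifies them with the
same `1/(Γ(αs+1) C_t)`. Since this includes an interval of `s` around `0`, the logarithms have the
same moment generating function there, hence the same law (`map_eq_map_of_mgf_eq`). The various
product formulas differ only by Gauss's multiplication formula, obtained by computing `C_t` for
`r(k) = k+1` with period `N` and with period `1`. -/

/-- A rank threshold sequence that increases by `ν` over each period of length `q`. -/
structure IsPeriodicThreshold (r : ℕ → ℕ) (q ν : ℕ) : Prop where
  isRankThreshold : IsRankThreshold r
  one_le : 1 ≤ ν
  le : ν ≤ q
  add_period : ∀ m : ℕ, 1 ≤ m → r (m + q) = r m + ν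

/-- The product `∏_{k < m} (1 + t / r(k))`. -/
def birthProd (r : ℕ → ℕ) (t : ℝ) (m : ℕ) : ℝ :=
  ∏ k ∈ Finset.range m, (1 + t / r k)

/-- The limit of `birthProd r t m / m ^ (t q / ν)` for a periodic threshold sequence. -/
def growthConst (r : ℕ → ℕ) (q ν : ℕ) (t : ℝ) : ℝ :=
  (1 + t) * (∏ i ∈ Finset.Icc 1 q,
    Real.Gamma ((r i : ℝ) / ν) / Real.Gamma (t / ν + (r i : ℝ) / ν)) / (q : ℝ) ^ (t * q / ν)

/-! ### Bounds on thresholds and positivity of the products. -/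

lemma IsRankThreshold.one_le {r : ℕ → ℕ} (hr : IsRankThreshold r) (m : ℕ) : 1 ≤ r m := by
  induction m with
  | zero => exact hr.1.ge
  | succ m ih => exact ih.trans (hr.2 m).1

lemma IsRankThreshold.le_succ {r : ℕ → ℕ} (hr : IsRankThreshold r) (m : ℕ) : r m ≤ m + 1 := by
  induction m with
  | zero => exact hr.1.le
  | succ m ih => have := (hr.2 m).2; omega

lemma IsRankThreshold.one_le_cast {r : ℕ → ℕ} (hr : IsRankThreshold r) (m : ℕ) :
    (1 : ℝ) ≤ r m := by
  exact_mod_cast hr.one_le m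

lemma IsRankThreshold.cast_pos {r : ℕ → ℕ} (hr : IsRankThreshold r) (m : ℕ) :
    (0 : ℝ) < r m := by
  have := hr.one_le_cast m
  linarith

lemma IsRankThreshold.min_le_one_add {r : ℕ → ℕ} (hr : IsRankThreshold r) (t : ℝ) (m : ℕ) :
    min 1 (1 + t) ≤ 1 + t / r m := by
  have h1 := hr.one_le_cast m
  rcases le_total 0 t with ht | ht
  · have : 0 ≤ t / r m := by positivity
    exact (min_le_left _ _).trans (by linarith)
  · refine (min_le_right _ _).trans ?_
    have : t ≤ t / r m := by
      rw [le_div_iff₀ (by linarith)]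
      nlinarith
    linarith

lemma IsRankThreshold.one_add_pos {r : ℕ → ℕ} (hr : IsRankThreshold r) {t : ℝ} (ht : -1 < t)
    (m : ℕ) : 0 < 1 + t / r m :=
  lt_of_lt_of_le (lt_min one_pos (by linarith)) (hr.min_le_one_add t m)

lemma birthProd_pos {r : ℕ → ℕ} (hr : IsRankThreshold r) {t : ℝ} (ht : -1 < t) (m : ℕ) :
    0 < birthProd r t m :=
  Finset.prod_pos fun k _ => hr.one_add_pos ht k

lemma birthProd_succ (r : ℕ → ℕ) (t : ℝ) (m : ℕ) :
    birthProd r t (m + 1) = birthProd r t m * (1 + t / r m) :=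
  Finset.prod_range_succ _ _

/-! ### Asymptotics of the products for periodic thresholds. -/

namespace IsPeriodicThreshold

variable {r : ℕ → ℕ} {q ν : ℕ}

lemma nu_pos (h : IsPeriodicThreshold r q ν) : (0 : ℝ) < ν := by
  exact_mod_cast h.one_le

lemma q_pos (h : IsPeriodicThreshold r q ν) : (0 : ℝ) < q := by
  exact_mod_cast h.one_le.trans h.le

/-- Subtracting a period changes neither side of the difference, so only `m ≤ q` matters, where both
terms lie in `[0, q+1]`. Periodicity starts at `1`, which is why the step requires `m > q` strictly.
-/
lemma abs_sub_le (h : IsPeriodicThreshold r q ν) (m : ℕ) :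
    |(r m : ℝ) - (ν : ℝ) / q * m| ≤ q + 1 := by
  have hq := h.q_pos
  have hν := h.nu_pos
  have hle : (ν : ℝ) ≤ q := by exact_mod_cast h.le
  induction m using Nat.strong_induction_on with
  | _ m ih =>
    rcases le_or_gt m q with hm | hm
    · have h1 : (r m : ℝ) ≤ m + 1 := by exact_mod_cast h.isRankThreshold.le_succ m
      have h2 : (m : ℝ) ≤ q := by exact_mod_cast hm
      have h3 : (ν : ℝ) / q * m ≤ q := by
        have : (ν : ℝ) / q ≤ 1 := (div_le_one hq).2 hle
        have hm0 : (0 : ℝ) ≤ m := m.cast_nonneg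
        nlinarith
      have h4 : 0 ≤ (ν : ℝ) / q * m := by positivity
      have h5 := h.isRankThreshold.cast_pos m
      rw [abs_le]
      constructor <;> linarith
    · have h1 := h.add_period (m - q) (by omega)
      have h2 := ih (m - q) (by have := h.one_le.trans h.le; omega)
      rw [Nat.sub_add_cancel hm.le] at h1
      rw [Nat.cast_sub hm.le] at h2
      rw [h1, Nat.cast_add]
      convert! h2 using 2
      field_simp
      ring

/-- Since `r ≥ 1`, `α(m+1) ≤ r(m+1) + q + 1 ≤ (q+2) r(m+1)`. -/
lemma inv_le (h : IsPeriodicThreshold r q ν) (m : ℕ) :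
    1 / (r (m + 1) : ℝ) ≤ (q + 2) / ((ν : ℝ) / q) * (1 / ((m + 1 : ℕ) : ℝ)) := by
  have hα : 0 < (ν : ℝ) / q := div_pos h.nu_pos h.q_pos
  have h1 := (abs_le.1 (h.abs_sub_le (m + 1))).1
  have h2 := h.isRankThreshold.one_le_cast (m + 1)
  have hm : (0 : ℝ) < ((m + 1 : ℕ) : ℝ) := by positivity
  have hq := h.q_pos
  rw [div_mul_div_comm, mul_one, div_le_div_iff₀ (by linarith) (by positivity)]
  nlinarith

lemma summable_inv_sub (h : IsPeriodicThreshold r q ν) :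
    Summable (fun m : ℕ => 1 / (r (m + 1) : ℝ) - 1 / ((ν : ℝ) / q * ((m + 1 : ℕ) : ℝ))) := by
  have hα : 0 < (ν : ℝ) / q := div_pos h.nu_pos h.q_pos
  have hs : Summable (fun m : ℕ => 1 / (((m + 1 : ℕ) : ℝ)) ^ 2) :=
    (summable_nat_add_iff 1).2 (Real.summable_one_div_nat_pow.2 one_lt_two)
  refine Summable.of_norm_bounded
    (hs.mul_left ((q + 1) / ((ν : ℝ) / q) * ((q + 2) / ((ν : ℝ) / q)))) fun m => ?_
  have hm : (0 : ℝ) < ((m + 1 : ℕ) : ℝ) := by positivity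
  have hr := h.isRankThreshold.cast_pos (m + 1)
  have h1 := h.abs_sub_le (m + 1)
  have h2 := h.inv_le m
  generalize hM : ((m + 1 : ℕ) : ℝ) = M at *
  generalize hA : (ν : ℝ) / q = A at *
  generalize hR : (r (m + 1) : ℝ) = R at *
  have e : 1 / R - 1 / (A * M) = (A * M - R) * ((1 / R) * (1 / (A * M))) := by
    field_simp
  rw [e, Real.norm_eq_abs, abs_mul, abs_sub_comm]
  have h3 : |(1 / R) * (1 / (A * M))| ≤ (q + 2) / A * (1 / M) * (1 / (A * M)) := by
    rw [abs_of_pos (by positivity)]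
    gcongr
  refine (mul_le_mul h1 h3 (abs_nonneg _) (by positivity)).trans (le_of_eq ?_)
  field_simp

lemma summable_inv_sq (h : IsPeriodicThreshold r q ν) :
    Summable (fun m : ℕ => (1 / (r m : ℝ)) ^ 2) := by
  rw [← summable_nat_add_iff 1]
  have hs : Summable (fun m : ℕ => 1 / (((m + 1 : ℕ) : ℝ)) ^ 2) :=
    (summable_nat_add_iff 1).2 (Real.summable_one_div_nat_pow.2 one_lt_two)
  refine Summable.of_nonneg_of_le (fun _ => by positivity) (fun m => ?_)
    (hs.mul_left (((q + 2) / ((ν : ℝ) / q)) ^ 2))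
  calc _ ≤ ((q + 2) / ((ν : ℝ) / q) * (1 / ((m + 1 : ℕ) : ℝ))) ^ 2 :=
        pow_le_pow_left₀ (by positivity) (h.inv_le m) 2
    _ = _ := by rw [mul_pow, one_div_pow]

lemma sum_inv_eq (h : IsPeriodicThreshold r q ν) (m : ℕ) :
    ∑ k ∈ Finset.range (m + 1), 1 / (r k : ℝ) =
      1 + ∑ k ∈ Finset.range m, (1 / (r (k + 1) : ℝ) - 1 / ((ν : ℝ) / q * ((k + 1 : ℕ) : ℝ)))
        + (q : ℝ) / ν * (harmonic m : ℝ) := by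
  have hq := h.q_pos
  have hν := h.nu_pos
  rw [Finset.sum_range_succ', h.isRankThreshold.1, Finset.sum_sub_distrib, harmonic]
  push_cast
  rw [Finset.mul_sum]
  have : ∀ k : ℕ, 1 / ((ν : ℝ) / q * ((k : ℝ) + 1)) = (q : ℝ) / ν * ((k : ℝ) + 1)⁻¹ := by
    intro k
    field_simp
  simp only [this]
  ring

lemma tendsto_sum_inv (h : IsPeriodicThreshold r q ν) :
    Tendsto (fun m : ℕ => ∑ k ∈ Finset.range (m + 1), 1 / (r k : ℝ)
      - (q : ℝ) / ν * Real.log (m + 1)) atTop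
      (𝓝 (1 + rho r ((ν : ℝ) / q) + q / ν * Real.eulerMascheroniConstant)) := by
  have h1 := h.summable_inv_sub.hasSum.tendsto_sum_nat
  have h2 := (Real.tendsto_harmonic_sub_log_add_one).const_mul ((q : ℝ) / ν)
  refine ((h1.const_add 1).add h2).congr fun m => ?_
  rw [h.sum_inv_eq]
  ring

/-- Existence of the limit only: `log(1+x) = x + O(x²)`, the squares `1/r(k)²` are summable, and the
linear part grows like `(t/α) log m` plus a constant. The value is read off later along a
subsequence. -/
lemma exists_tendsto_birthProd (h : IsPeriodicThreshold r q ν) {t : ℝ} (ht : -1 < t) :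
    ∃ c, Tendsto (fun m : ℕ => birthProd r t (m + 1) / ((m + 1 : ℕ) : ℝ) ^ (t * q / ν)) atTop
      (𝓝 c) := by
  have hr := h.isRankThreshold
  have hc : 0 < min 1 (1 + t) := lt_min one_pos (by linarith)
  have hs : Summable (fun k : ℕ => t / r k - Real.log (1 + t / r k)) := by
    refine Summable.of_nonneg_of_le (fun k => ?_) (fun k => ?_)
      (h.summable_inv_sq.mul_left (t ^ 2 / min 1 (1 + t)))
    · have := Real.log_le_sub_one_of_pos (hr.one_add_pos ht k)
      linarith
    · have hp := hr.one_add_pos ht k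
      have h1 := Real.one_sub_inv_le_log_of_pos hp
      have h2 := hr.min_le_one_add t k
      calc t / r k - Real.log (1 + t / r k) ≤ t / r k - (1 - (1 + t / r k)⁻¹) := by linarith
        _ = (t / r k) ^ 2 / (1 + t / r k) := by
          field_simp
          ring
        _ ≤ (t / r k) ^ 2 / min 1 (1 + t) := by gcongr
        _ = _ := by ring
  have h1 := hs.hasSum.tendsto_sum_nat.comp (tendsto_add_atTop_nat 1)
  have h2 := h.tendsto_sum_inv.const_mul t
  refine ⟨_, ((Real.continuous_exp.tendsto _).comp (h2.sub h1)).congr fun m => ?_⟩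
  have hm : (0 : ℝ) < (m : ℝ) + 1 := by positivity
  have hp := birthProd_pos hr ht (m + 1)
  simp only [Function.comp_apply]
  rw [← Real.exp_log hp, Nat.cast_add_one, Real.rpow_def_of_pos hm, ← Real.exp_sub, birthProd,
    Real.log_prod fun k _ => (hr.one_add_pos ht k).ne', Finset.sum_sub_distrib, mul_sub,
    Finset.mul_sum]
  congr 1
  simp only [mul_one_div]
  ring

lemma add_mul_period (h : IsPeriodicThreshold r q ν) (m J : ℕ) (hm : 1 ≤ m) :
    r (m + J * q) = r m + J * ν := by
  induction J with
  | zero => simp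
  | succ J ih =>
    rw [add_mul, one_mul, ← add_assoc, h.add_period _ (by omega), ih]
    ring

/-- Grouping indices by residue modulo `q` makes `r` an arithmetic progression in each class, so
each class yields a Gamma ratio. The index `0` stands apart, being outside the periodic range; it
gives the factor `1 + t`. -/
lemma birthProd_mul_add_one (h : IsPeriodicThreshold r q ν) (t : ℝ) (J : ℕ) :
    birthProd r t (J * q + 1) = (1 + t) * ∏ i ∈ Finset.Icc 1 q, ∏ j ∈ Finset.range J,
      (1 + t / ν / ((r i : ℝ) / ν + j)) := by
  have hν := h.nu_pos
  induction J with
  | zero => simp [birthProd, h.isRankThreshold.1]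
  | succ J ih =>
    have e : (J + 1) * q + 1 = (J * q + 1) + q := by ring
    rw [e, birthProd, Finset.prod_range_add, ← birthProd, ih, mul_assoc]
    congr 1
    simp only [Finset.prod_range_succ]
    rw [Finset.prod_mul_distrib]
    congr 1
    rw [Finset.range_eq_Ico, ← Finset.Ico_add_one_right_eq_Icc,
      ← Finset.prod_Ico_add' _ 0 q 1]
    refine Finset.prod_congr rfl fun i _ => ?_
    have e2 : J * q + 1 + i = (i + 1) + J * q := by ring
    rw [e2, h.add_mul_period _ _ (by omega)]
    have := h.isRankThreshold.cast_pos (i + 1)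
    push_cast
    field_simp

end IsPeriodicThreshold

/-- Quotient of Euler's limit formulas at `a` and `a + b`. `Real.GammaSeq` has `n+1` factors, and
`h2` removes the surplus one. -/
lemma tendsto_prod_one_add_div {a b : ℝ} (ha : 0 < a) (hab : 0 < a + b) :
    Tendsto (fun n : ℕ => (∏ j ∈ Finset.range n, (1 + b / (a + j))) / (n : ℝ) ^ b) atTop
      (𝓝 (Real.Gamma a / Real.Gamma (b + a))) := by
  have h1 := (Real.GammaSeq_tendsto_Gamma a).div (Real.GammaSeq_tendsto_Gamma (b + a))
    (Real.Gamma_pos_of_pos (by linarith)).ne'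
  have h2 : Tendsto (fun n : ℕ => (1 + b / (a + n))⁻¹) atTop (𝓝 1) := by
    have : Tendsto (fun n : ℕ => a + (n : ℝ)) atTop atTop :=
      tendsto_atTop_add_const_left _ _ tendsto_natCast_atTop_atTop
    have h3 := ((tendsto_const_nhds (x := b)).div_atTop this).const_add 1
    simpa using h3.inv₀ (by norm_num)
  have h3 := h1.mul h2
  rw [mul_one] at h3
  refine h3.congr' ?_
  filter_upwards [eventually_gt_atTop 0] with n hn
  have hn' : (0 : ℝ) < n := by exact_mod_cast hn
  have hp : ∀ j : ℕ, 0 < a + j := fun j => by positivity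
  have hpb : ∀ j : ℕ, 0 < b + a + j := fun j => by
    have : (0 : ℝ) ≤ j := j.cast_nonneg
    linarith
  have e : ∀ j : ℕ, 1 + b / (a + j) = (b + a + j) / (a + j) := fun j => by
    have := (hp j).ne'
    field_simp
    ring
  have hP : ∏ j ∈ Finset.range n, (b + a + (j : ℝ)) ≠ 0 :=
    Finset.prod_ne_zero_iff.2 fun j _ => (hpb j).ne'
  have hQ : ∏ j ∈ Finset.range n, (a + (j : ℝ)) ≠ 0 :=
    Finset.prod_ne_zero_iff.2 fun j _ => (hp j).ne'
  simp only [Pi.div_apply, Real.GammaSeq, e, Finset.prod_range_succ, Finset.prod_div_distrib]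
  rw [Real.rpow_add hn' b a]
  have h4 := (hp n).ne'
  have h5 := (hpb n).ne'
  have h6 := (Real.rpow_pos_of_pos hn' a).ne'
  have h7 := (Real.rpow_pos_of_pos hn' b).ne'
  have h8 : ((n.factorial : ℕ) : ℝ) ≠ 0 := by exact_mod_cast n.factorial_ne_zero
  field_simp

namespace IsPeriodicThreshold

variable {r : ℕ → ℕ} {q ν : ℕ}

lemma growthConst_pos (h : IsPeriodicThreshold r q ν) {t : ℝ} (ht : -1 < t) :
    0 < growthConst r q ν t := by
  have hq := h.q_pos
  have hν := h.nu_pos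
  refine div_pos (mul_pos (by linarith) (Finset.prod_pos fun i _ => ?_)) (by positivity)
  have h1 := h.isRankThreshold.one_le_cast i
  refine div_pos (Real.Gamma_pos_of_pos (by positivity)) (Real.Gamma_pos_of_pos ?_)
  rw [← add_div]
  exact div_pos (by linarith) hν

theorem tendsto_birthProd (h : IsPeriodicThreshold r q ν) {t : ℝ} (ht : -1 < t) :
    Tendsto (fun m : ℕ => birthProd r t m / (m : ℝ) ^ (t * q / ν)) atTop
      (𝓝 (growthConst r q ν t)) := by
  have hq := h.q_pos
  have hν := h.nu_pos
  have hq1 : 1 ≤ q := h.one_le.trans h.le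
  obtain ⟨c, hc⟩ := h.exists_tendsto_birthProd ht
  have hsub : Tendsto (fun J : ℕ => J * q) atTop atTop :=
    tendsto_id.atTop_mul_const' (by omega)
  have h1 := hc.comp hsub
  have h2 : Tendsto (fun J : ℕ => (1 + t) * (∏ i ∈ Finset.Icc 1 q,
      (∏ j ∈ Finset.range J, (1 + t / ν / ((r i : ℝ) / ν + j))) / (J : ℝ) ^ (t / ν))) atTop
      (𝓝 ((1 + t) * ∏ i ∈ Finset.Icc 1 q,
        Real.Gamma ((r i : ℝ) / ν) / Real.Gamma (t / ν + (r i : ℝ) / ν))) := by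
    refine (tendsto_finsetProd _ fun i _ => ?_).const_mul _
    have h1 := h.isRankThreshold.one_le_cast i
    refine tendsto_prod_one_add_div (by positivity) ?_
    rw [← add_div]
    exact div_pos (by linarith) hν
  have h3 : Tendsto (fun J : ℕ => ((J : ℝ) / ((J * q + 1 : ℕ) : ℝ)) ^ (t * q / ν)) atTop
      (𝓝 ((1 / (q : ℝ)) ^ (t * q / ν))) := by
    refine Tendsto.rpow_const ?_ (Or.inl (by positivity))
    have h4 : Tendsto (fun J : ℕ => 1 / ((q : ℝ) + 1 / (J : ℝ))) atTop (𝓝 (1 / ((q : ℝ) + 0))) :=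
      tendsto_const_nhds.div (tendsto_one_div_atTop_nhds_zero_nat.const_add _)
        (by simpa using hq.ne')
    rw [add_zero] at h4
    refine h4.congr' ?_
    filter_upwards [eventually_gt_atTop 0] with J hJ
    have : (0 : ℝ) < J := by exact_mod_cast hJ
    push_cast
    field_simp
  -- The full limit exists, so it may be computed along the indices `J q + 1`.
  have hlim : c = growthConst r q ν t := by
    refine tendsto_nhds_unique h1 ?_
    have h5 := h2.mul h3
    rw [Real.div_rpow zero_le_one hq.le, Real.one_rpow, mul_one_div] at h5
    refine h5.congr' ?_
    filter_upwards [eventually_gt_atTop 0] with J hJ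
    have hJ' : (0 : ℝ) < J := by exact_mod_cast hJ
    have hJ2 : (0 : ℝ) ≤ ((J * q + 1 : ℕ) : ℝ) := Nat.cast_nonneg _
    simp only [Function.comp_apply]
    rw [h.birthProd_mul_add_one, Finset.prod_div_distrib, Finset.prod_const, Nat.card_Icc,
      Nat.add_sub_cancel, ← Real.rpow_mul_natCast hJ'.le, div_mul_eq_mul_div t (ν : ℝ) (q : ℝ),
      Real.div_rpow hJ'.le hJ2]
    have := (Real.rpow_pos_of_pos hJ' (t * q / ν)).ne'
    field_simp
  rw [← hlim]
  exact (tendsto_add_atTop_iff_nat 1).1 hc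

end IsPeriodicThreshold

/-! ### Gauss's multiplication formula from the threshold `k + 1`. -/

lemma isPeriodicThreshold_succ {N : ℕ} (hN : 1 ≤ N) :
    IsPeriodicThreshold (fun k => k + 1) N N :=
  ⟨⟨rfl, fun m => ⟨Nat.le_succ _, le_rfl⟩⟩, hN, le_rfl, fun m _ => by ring⟩

lemma growthConst_succ_one {t : ℝ} (ht : -1 < t) :
    growthConst (fun k => k + 1) 1 1 t = 1 / Real.Gamma (t + 1) := by
  have h1 : t + 1 ≠ 0 := by linarith
  have h2 := (Real.Gamma_pos_of_pos (by linarith : 0 < t + 1)).ne'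
  have e : t + 2 = (t + 1) + 1 := by ring
  simp only [growthConst, Finset.Icc_self, Finset.prod_singleton]
  norm_num
  rw [e, Real.Gamma_add_one h1]
  field_simp
  ring

/-- The growth rate of `∏_{k=1}^n (1 + t / k)`. -/
lemma tendsto_birthProd_succ {t : ℝ} (ht : -1 < t) :
    Tendsto (fun n : ℕ => birthProd (fun k => k + 1) t n / (n : ℝ) ^ t) atTop
      (𝓝 (1 / Real.Gamma (t + 1))) := by
  have := (isPeriodicThreshold_succ le_rfl).tendsto_birthProd ht
  rw [growthConst_succ_one ht] at this
  simpa using this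

/-- A form of Gauss's multiplication formula. -/
lemma prod_Gamma_div_Gamma {N : ℕ} (hN : 1 ≤ N) {t : ℝ} (ht : -1 < t) :
    ∏ j ∈ Finset.Icc 2 (N + 1), Real.Gamma ((j : ℝ) / N) / Real.Gamma (t / N + (j : ℝ) / N) =
      (N : ℝ) ^ t / Real.Gamma (t + 2) := by
  have hN' : (0 : ℝ) < N := by exact_mod_cast hN
  have h1 := (isPeriodicThreshold_succ hN).tendsto_birthProd ht
  have e : t * N / N = t := by field_simp
  rw [e] at h1
  -- The threshold `k + 1` has every period `N`, and its product does not depend on the period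
  -- chosen: the growth constants for `N` and for `1` coincide.
  have h2 := tendsto_nhds_unique h1 (tendsto_birthProd_succ ht)
  have h3 : t + 1 ≠ 0 := by linarith
  have h4 := (Real.Gamma_pos_of_pos (by linarith : 0 < t + 1)).ne'
  have e2 : t + 2 = (t + 1) + 1 := by ring
  have h5 := (Real.rpow_pos_of_pos hN' t).ne'
  have h6 : ∏ j ∈ Finset.Icc 2 (N + 1),
      Real.Gamma ((j : ℝ) / N) / Real.Gamma (t / N + (j : ℝ) / N) =
      ∏ i ∈ Finset.Icc 1 N, Real.Gamma (((i + 1 : ℕ) : ℝ) / N) /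
        Real.Gamma (t / N + ((i + 1 : ℕ) : ℝ) / N) := by
    rw [← Finset.Ico_add_one_right_eq_Icc, ← Finset.Ico_add_one_right_eq_Icc]
    exact (Finset.prod_Ico_add'
      (fun j : ℕ => Real.Gamma ((j : ℝ) / N) / Real.Gamma (t / N + (j : ℝ) / N)) 1 (N + 1) 1).symm
  rw [h6, e2, Real.Gamma_add_one h3]
  rw [growthConst, e] at h2
  generalize ∏ i ∈ Finset.Icc 1 N, Real.Gamma (((i + 1 : ℕ) : ℝ) / N) /
        Real.Gamma (t / N + ((i + 1 : ℕ) : ℝ) / N) = p at *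
  field_simp at h2 ⊢
  linarith

/-- The factor `j = N + 1` is traded for `j = 1` by `Γ(x+1) = x Γ(x)`, at the cost of a factor `t +
1`. -/
lemma prod_Gamma_div_Gamma_one {N : ℕ} (hN : 1 ≤ N) {t : ℝ} (ht : -1 < t) :
    ∏ j ∈ Finset.Icc 1 N, Real.Gamma ((j : ℝ) / N) / Real.Gamma (t / N + (j : ℝ) / N) =
      (N : ℝ) ^ t / Real.Gamma (t + 1) := by
  have hN' : (0 : ℝ) < N := by exact_mod_cast hN
  have h1 := prod_Gamma_div_Gamma hN ht
  have h2 : 0 < t + 1 := by linarith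
  have e2 : t + 2 = (t + 1) + 1 := by ring
  have e3 : ((N + 1 : ℕ) : ℝ) / N = 1 / N + 1 := by
    push_cast
    field_simp
    ring
  have e4 : t / N + (1 / N + 1) = (t + 1) / N + 1 := by ring
  rw [Finset.prod_Icc_succ_top (by omega), e2, Real.Gamma_add_one h2.ne', e3, e4,
    Real.Gamma_add_one (by positivity), Real.Gamma_add_one (by positivity)] at h1
  rw [← Finset.mul_prod_Ioc_eq_prod_Icc hN, Nat.cast_one, ← add_div]
  have e5 : Finset.Icc 2 N = Finset.Ioc 1 N := rfl
  rw [e5] at h1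
  have h4 := (Real.Gamma_pos_of_pos h2).ne'
  have h5 := (Real.Gamma_pos_of_pos (by positivity : 0 < (t + 1) / N)).ne'
  have h6 := (Real.Gamma_pos_of_pos (by positivity : 0 < 1 / (N : ℝ))).ne'
  generalize ∏ j ∈ Finset.Ioc 1 N, Real.Gamma ((j : ℝ) / N) / Real.Gamma (t / N + (j : ℝ) / N)
    = p at *
  generalize (N : ℝ) ^ t = u at *
  field_simp at h1 ⊢
  linarith

end

end Hiring

namespace Hiring

noncomputable section

/-! ### The number of accepted candidates through relative ranks -/

/-- The number of indices `j ≠ i` in `{1, …, N}` with `x j ≥ x i`. -/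
def rankAmong (x : ℕ → ℝ) (N i : ℕ) : ℕ :=
  (((Finset.Icc 1 N).erase i).filter (fun j => x i ≤ x j)).card

open Classical in
lemma kthBest_lt_iff (s : Multiset ℝ) {k : ℕ} (hk : 1 ≤ k) (hks : k ≤ s.card) (x : ℝ) :
    kthBest s k < x ↔ s.countP (x ≤ ·) < k := by
  have hsort : (s.sort (fun a b => a ≥ b)).Pairwise (fun a b => a ≥ b) :=
    Multiset.pairwise_sort s _
  have hs : ((s.sort (fun a b => a ≥ b) : List ℝ) : Multiset ℝ) = s := Multiset.sort_eq s _
  unfold kthBest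
  generalize s.sort (fun a b => a ≥ b) = l at hsort hs
  subst hs
  rw [Multiset.coe_card] at hks
  rw [Multiset.coe_countP, List.getD_eq_getElem _ _ (by omega)]
  have hidx : k - 1 < l.length := by omega
  constructor
  · intro h
    rw [← List.take_append_drop (k - 1) l, List.countP_append]
    have h1 : (l.take (k - 1)).countP (x ≤ ·) ≤ k - 1 :=
      List.countP_le_length.trans (by simp)
    have h2 : (l.drop (k - 1)).countP (x ≤ ·) = 0 := by
      rw [List.countP_eq_zero]
      intro a ha
      rw [List.mem_drop_iff_getElem] at ha
      obtain ⟨i, hi, rfl⟩ := ha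
      have h3 : l[k - 1 + i] ≤ l[k - 1] := by
        rcases Nat.eq_zero_or_pos i with rfl | hi0
        · simp
        · exact List.pairwise_iff_getElem.1 hsort _ _ hidx (by omega) (by omega)
      simpa using lt_of_le_of_lt h3 h
    omega
  · intro h
    by_contra hx
    rw [not_lt] at hx
    have h1 : (l.take k).countP (x ≤ ·) = k := by
      have : (l.take k).countP (x ≤ ·) = (l.take k).length := by
        rw [List.countP_eq_length]
        intro a ha
        rw [List.mem_take_iff_getElem] at ha
        obtain ⟨i, hi, rfl⟩ := ha
        have h3 : l[k - 1] ≤ l[i] := by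
          rcases Nat.lt_or_ge i (k - 1) with h4 | h4
          · exact List.pairwise_iff_getElem.1 hsort _ _ (by omega) hidx h4
          · have : i = k - 1 := by omega
            subst this
            exact le_rfl
        simpa using hx.trans h3
      rw [this, List.length_take]
      omega
    have h2 := (List.take_sublist k l).countP_le (p := fun a => decide (x ≤ a))
    omega

open Classical in
-- The two clauses of the rule merge: when `r(m) = m + 1` the count, at most `m`, is automatically
-- small enough.
lemma accepts_iff {r : ℕ → ℕ} (hr : IsRankThreshold r) (s : Multiset ℝ) (x : ℝ) :
    Accepts r s x ↔ s.countP (x ≤ ·) < r s.card := by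
  unfold Accepts
  have h1 := hr.le_succ s.card
  have h2 := hr.one_le s.card
  have h3 : s.countP (x ≤ ·) ≤ s.card := Multiset.countP_le_card _ _
  rcases h1.eq_or_lt with h | h
  · simp only [h, true_or, true_iff]
    omega
  · rw [kthBest_lt_iff s h2 (by omega)]
    simp [h.ne]

open Classical in
-- A value `y` that would pass now has seen no candidate at or above it rejected. Going back one
-- step, `y` would have passed before too: if the last candidate was accepted at or above `y`,
-- because `r` grows by at most one; if accepted below `y`, because she herself passed. If she was
-- rejected, she lies below `y`.
lemma countP_acceptedValues {r : ℕ → ℕ} (hr : IsRankThreshold r) (x : ℕ → ℝ) (n : ℕ) (y : ℝ)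
    (hy : (acceptedValues r x n).countP (y ≤ ·) < r (acceptedValues r x n).card) :
    ((Finset.Icc 1 n).filter (fun j => y ≤ x j)).card =
      (acceptedValues r x n).countP (y ≤ ·) := by
  induction n generalizing y with
  | zero => simp [acceptedValues]
  | succ n ih =>
    have e : Finset.Icc 1 (n + 1) = insert (n + 1) (Finset.Icc 1 n) := by
      ext j
      simp only [Finset.mem_Icc, Finset.mem_insert]
      omega
    have hmem : n + 1 ∉ (Finset.Icc 1 n).filter (fun j => y ≤ x j) := by simp
    rw [e, Finset.filter_insert]
    have hmono : y ≤ x (n + 1) → (acceptedValues r x n).countP (x (n + 1) ≤ ·) ≤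
        (acceptedValues r x n).countP (y ≤ ·) := fun h => by
      rw [Multiset.countP_eq_card_filter, Multiset.countP_eq_card_filter]
      exact Multiset.card_le_card
        (Multiset.monotone_filter_right _ fun a ha => h.trans ha)
    by_cases hacc : Accepts r (acceptedValues r x n) (x (n + 1))
    · have hacc' := (accepts_iff hr _ _).1 hacc
      simp only [acceptedValues, if_pos hacc, Multiset.card_cons, Multiset.countP_cons] at hy ⊢
      have hstep := (hr.2 (acceptedValues r x n).card).2
      by_cases hyx : y ≤ x (n + 1)
      · rw [if_pos hyx] at hy ⊢
        rw [Finset.card_insert_of_notMem hmem, if_pos hyx, ih y (by omega)]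
      · rw [if_neg hyx] at hy ⊢
        rw [if_neg hyx, add_zero, ih y ?_]
        have : (acceptedValues r x n).countP (y ≤ ·) ≤
            (acceptedValues r x n).countP (x (n + 1) ≤ ·) := by
          rw [Multiset.countP_eq_card_filter, Multiset.countP_eq_card_filter]
          exact Multiset.card_le_card
            (Multiset.monotone_filter_right _ fun a ha => (not_le.1 hyx).le.trans ha)
        omega
    · have hacc' := mt (accepts_iff hr _ _).2 hacc
      simp only [acceptedValues, if_neg hacc] at hy ⊢
      have hyx : ¬ y ≤ x (n + 1) := fun h => by
        have := hmono h
        omega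
      rw [if_neg hyx, ih y hy]

lemma accepts_acceptedValues_iff {r : ℕ → ℕ} (hr : IsRankThreshold r) (x : ℕ → ℝ) (n : ℕ) :
    Accepts r (acceptedValues r x n) (x (n + 1)) ↔
      rankAmong x (n + 1) (n + 1) < r (numAccepted r x n) := by
  classical
  have e : (Finset.Icc 1 (n + 1)).erase (n + 1) = Finset.Icc 1 n := by
    ext j
    simp only [Finset.mem_Icc, Finset.mem_erase]
    omega
  rw [accepts_iff hr, rankAmong, e, numAccepted]
  constructor
  · intro h
    rwa [countP_acceptedValues hr x n _ h]
  · intro h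
    by_contra hc
    push Not at hc

    have hle : ∀ m : ℕ, (acceptedValues r x m).countP (x (n + 1) ≤ ·) ≤
        ((Finset.Icc 1 m).filter (fun j => x (n + 1) ≤ x j)).card := by
      intro m
      induction m with
      | zero => simp [acceptedValues]
      | succ m ih =>
        have e : Finset.Icc 1 (m + 1) = insert (m + 1) (Finset.Icc 1 m) := by
          ext j
          simp only [Finset.mem_Icc, Finset.mem_insert]
          omega
        have hmem : m + 1 ∉ (Finset.Icc 1 m).filter (fun j => x (n + 1) ≤ x j) := by simp
        rw [e, Finset.filter_insert, acceptedValues]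
        split_ifs with h1 h2 h2
        · rw [Multiset.countP_cons, if_pos h2, Finset.card_insert_of_notMem hmem]
          omega
        · rw [Multiset.countP_cons, if_neg h2]
          omega
        · rw [Finset.card_insert_of_notMem hmem]
          omega
        · exact ih
    have := hle n
    omega

lemma numAccepted_zero (r : ℕ → ℕ) (x : ℕ → ℝ) : numAccepted r x 0 = 0 := rfl

lemma numAccepted_succ {r : ℕ → ℕ} (hr : IsRankThreshold r) (x : ℕ → ℝ) (n : ℕ) :
    numAccepted r x (n + 1) = numAccepted r x n +
      if rankAmong x (n + 1) (n + 1) < r (numAccepted r x n) then 1 else 0 := by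
  classical
  have h := accepts_acceptedValues_iff hr x n
  split_ifs with h1
  · rw [numAccepted, acceptedValues, if_pos (h.2 h1), Multiset.card_cons, numAccepted]
  · rw [numAccepted, acceptedValues, if_neg (mt h.1 h1), numAccepted, add_zero]

lemma numAccepted_le {r : ℕ → ℕ} (hr : IsRankThreshold r) (x : ℕ → ℝ) (n : ℕ) :
    numAccepted r x n ≤ n := by
  induction n with
  | zero => exact le_rfl
  | succ n ih =>
    rw [numAccepted_succ hr]
    split_ifs <;> omega

lemma one_le_numAccepted {r : ℕ → ℕ} (hr : IsRankThreshold r) (x : ℕ → ℝ) {n : ℕ} (hn : 1 ≤ n) :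
    1 ≤ numAccepted r x n := by
  induction n, hn using Nat.le_induction with
  | base =>
    rw [numAccepted_succ hr, numAccepted_zero, hr.1, if_pos (by simp [rankAmong])]
  | succ n _ ih =>
    rw [numAccepted_succ hr]
    omega

lemma measurable_rankAmong (N i : ℕ) : Measurable (fun x : ℕ → ℝ => rankAmong x N i) := by
  simp only [rankAmong, Finset.card_filter]
  exact Finset.measurable_fun_sum _ fun j _ => Measurable.ite
    (measurableSet_le (measurable_pi_apply i) (measurable_pi_apply j))
    measurable_const measurable_const

lemma measurable_numAccepted {r : ℕ → ℕ} (hr : IsRankThreshold r) (n : ℕ) :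
    Measurable (fun x : ℕ → ℝ => numAccepted r x n) := by
  induction n with
  | zero => exact measurable_const
  | succ n ih =>
    simp only [numAccepted_succ hr]
    exact ih.add (Measurable.ite (measurableSet_lt (measurable_rankAmong _ _)
      ((measurable_from_nat (f := r)).comp ih)) measurable_const measurable_const)

/-- Only the relative order of the values enters the recursion. -/
lemma numAccepted_congr {r : ℕ → ℕ} (hr : IsRankThreshold r) {x y : ℕ → ℝ} {n : ℕ}
    (hxy : ∀ i ∈ Finset.Icc 1 n, ∀ j ∈ Finset.Icc 1 n, (x i ≤ x j ↔ y i ≤ y j)) {m : ℕ}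
    (hm : m ≤ n) : numAccepted r x m = numAccepted r y m := by
  induction m with
  | zero => rfl
  | succ m ih =>
    have h : rankAmong x (m + 1) (m + 1) = rankAmong y (m + 1) (m + 1) := by
      unfold rankAmong
      congr 1
      refine Finset.filter_congr fun j hj => hxy _ ?_ _ ?_
      · simp only [Finset.mem_Icc]
        omega
      · simp only [Finset.mem_Icc, Finset.mem_erase] at hj ⊢
        omega
    rw [numAccepted_succ hr, numAccepted_succ hr, ih (by omega), h]

/-! ### Exchanging two candidates of adjacent ranks -/

lemma rankAmong_lt {x : ℕ → ℝ} {N a b : ℕ} (ha : a ∈ Finset.Icc 1 N) (hab : x b < x a) :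
    rankAmong x N a < rankAmong x N b := by
  refine Finset.card_lt_card (Finset.ssubset_iff_subset_ne.2 ⟨fun j hj => ?_, fun he => ?_⟩)
  · simp only [Finset.mem_filter, Finset.mem_erase] at hj ⊢
    refine ⟨⟨?_, hj.1.2⟩, hab.le.trans hj.2⟩
    rintro rfl
    exact absurd hj.2 (not_le.2 hab)
  · have : a ∈ ((Finset.Icc 1 N).erase b).filter (fun j => x b ≤ x j) := by
      simp only [Finset.mem_filter, Finset.mem_erase]
      exact ⟨⟨fun h => by simp [h] at hab, ha⟩, hab.le⟩
    rw [← he] at this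
    simp at this

lemma rankAmong_lt_card {x : ℕ → ℝ} {N a : ℕ} (ha : a ∈ Finset.Icc 1 N) :
    rankAmong x N a < N := by
  refine (Finset.card_filter_le _ _).trans_lt ?_
  rw [Finset.card_erase_of_mem ha, Nat.card_Icc]
  simp only [Finset.mem_Icc] at ha
  omega

lemma rankAmong_injOn {x : ℕ → ℝ} (hx : Function.Injective x) (N : ℕ) :
    Set.InjOn (rankAmong x N) (Finset.Icc 1 N : Finset ℕ) := by
  intro a ha b hb h
  by_contra hab
  rcases lt_or_gt_of_ne (hx.ne hab) with h1 | h1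
  · exact (rankAmong_lt hb h1).ne' h
  · exact (rankAmong_lt ha h1).ne h

lemma exists_rankAmong_eq {x : ℕ → ℝ} (hx : Function.Injective x) {N k : ℕ} (hk : k < N) :
    ∃ j ∈ Finset.Icc 1 N, rankAmong x N j = k := by
  have h1 : (Finset.Icc 1 N).image (rankAmong x N) = Finset.range N := by
    refine Finset.eq_of_subset_of_card_le (fun a ha => ?_) ?_
    · obtain ⟨j, hj, rfl⟩ := Finset.mem_image.1 ha
      exact Finset.mem_range.2 (rankAmong_lt_card hj)
    · rw [Finset.card_image_of_injOn (rankAmong_injOn hx N)]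
      simp
  have h2 : k ∈ (Finset.Icc 1 N).image (rankAmong x N) := by
    rw [h1]
    exact Finset.mem_range.2 hk
  exact Finset.mem_image.1 h2

/-- No third value lies between two values of adjacent ranks. -/
lemma le_iff_le_of_rankAmong_eq_succ {x : ℕ → ℝ} (hx : Function.Injective x) {N a b i : ℕ}
    (ha : a ∈ Finset.Icc 1 N) (hb : b ∈ Finset.Icc 1 N) (hi : i ∈ Finset.Icc 1 N)
    (hia : i ≠ a) (hib : i ≠ b) (hab : rankAmong x N a = rankAmong x N b + 1) :
    (x a ≤ x i ↔ x b ≤ x i) ∧ (x i ≤ x a ↔ x i ≤ x b) := by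
  have hlt : x a < x b := by
    by_contra h
    rcases (not_lt.1 h).eq_or_lt with h1 | h1
    · have := hx h1
      subst this
      omega
    · have := rankAmong_lt ha h1
      omega
  have key : x a ≤ x i → x b ≤ x i := by
    intro hai
    by_contra hbi
    rw [not_le] at hbi
    have h1 := rankAmong_lt hb hbi
    have h2 := rankAmong_lt hi (lt_of_le_of_ne hai (hx.ne hia.symm))
    omega
  refine ⟨⟨key, fun h => hlt.le.trans h⟩, fun h => h.trans hlt.le, fun h => ?_⟩
  by_contra h1
  exact hib (hx (le_antisymm h (key (not_le.1 h1).le)))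

lemma rankAmong_comp (x : ℕ → ℝ) (N : ℕ) (τ : Equiv.Perm ℕ)
    (hτ : ∀ i, τ i ∈ Finset.Icc 1 N ↔ i ∈ Finset.Icc 1 N) (i : ℕ) :
    rankAmong (x ∘ τ) N i = rankAmong x N (τ i) := by
  refine Finset.card_bij (fun j _ => τ j) (fun j hj => ?_) (fun _ _ _ _ h => τ.injective h)
    (fun j hj => ⟨τ.symm j, ?_, by simp⟩)
  · simp only [Finset.mem_filter, Finset.mem_erase, Function.comp_apply] at hj ⊢
    exact ⟨⟨fun h => hj.1.1 (τ.injective h), (hτ j).2 hj.1.2⟩, hj.2⟩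
  · simp only [Finset.mem_filter, Finset.mem_erase, Function.comp_apply] at hj ⊢
    refine ⟨⟨fun h => hj.1.1 (by simp [← h]), (hτ _).1 (by simpa using hj.1.2)⟩,
      by simpa using hj.2⟩

/-- Exchanging adjacent ranks alters only the mutual order of `j` and `n + 1`, and this is invisible
to the first `n` candidates. -/
lemma numAccepted_comp_swap {r : ℕ → ℕ} (hr : IsRankThreshold r) {x : ℕ → ℝ}
    (hx : Function.Injective x) {n j : ℕ} (hj : j ∈ Finset.Icc 1 n)
    (hadj : rankAmong x (n + 1) j = rankAmong x (n + 1) (n + 1) + 1 ∨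
      rankAmong x (n + 1) (n + 1) = rankAmong x (n + 1) j + 1) {m : ℕ} (hm : m ≤ n) :
    numAccepted r (x ∘ Equiv.swap j (n + 1)) m = numAccepted r x m := by
  have hsub : ∀ i ∈ Finset.Icc 1 n, i ∈ Finset.Icc 1 (n + 1) ∧ i ≠ n + 1 := fun i hi => by
    simp only [Finset.mem_Icc] at hi ⊢
    omega
  have hN : n + 1 ∈ Finset.Icc 1 (n + 1) := by simp
  have key : ∀ i ∈ Finset.Icc 1 n, i ≠ j →
      (x j ≤ x i ↔ x (n + 1) ≤ x i) ∧ (x i ≤ x j ↔ x i ≤ x (n + 1)) := by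
    intro i hi hij
    rcases hadj with h | h
    · exact le_iff_le_of_rankAmong_eq_succ hx (hsub j hj).1 hN (hsub i hi).1 hij (hsub i hi).2 h
    · have := le_iff_le_of_rankAmong_eq_succ hx hN (hsub j hj).1 (hsub i hi).1 (hsub i hi).2 hij h
      exact ⟨this.1.symm, this.2.symm⟩
  refine numAccepted_congr hr (fun i hi i' hi' => ?_) hm
  have e1 : ∀ i ∈ Finset.Icc 1 n, i ≠ j → Equiv.swap j (n + 1) i = i := fun i hi hij =>
    Equiv.swap_apply_of_ne_of_ne hij (hsub i hi).2
  simp only [Function.comp_apply]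
  by_cases h1 : i = j
  · by_cases h2 : i' = j
    · simp [h1, h2]
    · rw [e1 i' hi' h2, h1, Equiv.swap_apply_left]
      exact (key i' hi' h2).1.symm
  · rw [e1 i hi h1]
    by_cases h2 : i' = j
    · rw [h2, Equiv.swap_apply_left]
      exact (key i hi h1).2.symm
    · rw [e1 i' hi' h2]

end

end Hiring

namespace Hiring

noncomputable section

/-! ### Uniform relative ranks and the transition law of `M`. -/

/-- A law on sequences that is invariant under transpositions of coordinates and charges only
sequences without repetitions. -/
structure IsExchangeableLaw (Q : Measure (ℕ → ℝ)) : Prop where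
  map_swap : ∀ i j : ℕ, Q.map (fun x => x ∘ Equiv.swap i j) = Q
  ae_injective : ∀ᵐ x ∂Q, Function.Injective x

/-- The numbers of accepted candidates up to time `n`. -/
def history (r : ℕ → ℕ) (n : ℕ) (x : ℕ → ℝ) : ℕ → ℕ :=
  fun i => numAccepted r x (min i n)

lemma measurable_history {r : ℕ → ℕ} (hr : IsRankThreshold r) (n : ℕ) :
    Measurable (history r n) :=
  measurable_pi_iff.2 fun _ => measurable_numAccepted hr _

/-- The filtration generated by the numbers of accepted candidates. -/
def historyFiltration {r : ℕ → ℕ} (hr : IsRankThreshold r) :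
    Filtration ℕ (inferInstance : MeasurableSpace (ℕ → ℝ)) where
  seq n := MeasurableSpace.comap (history r n) inferInstance
  mono' n m hnm := by
    have h : history r n = (fun b : ℕ → ℕ => fun i => b (min i n)) ∘ history r m := by
      funext x i
      simp only [history, Function.comp_apply]
      rw [min_assoc, min_eq_left hnm]
    show MeasurableSpace.comap (history r n) _ ≤ MeasurableSpace.comap (history r m) _
    rw [h, ← MeasurableSpace.comap_comp]
    exact MeasurableSpace.comap_mono
      (measurable_pi_iff.2 fun i => measurable_pi_apply _ : Measurable
        (fun b : ℕ → ℕ => fun i => b (min i n))).comap_le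
  le' n := (measurable_history hr n).comap_le

lemma measurable_numAccepted_historyFiltration {r : ℕ → ℕ} (hr : IsRankThreshold r) (n : ℕ) :
    Measurable[historyFiltration hr n] (fun x => numAccepted r x n) := by
  have h : (fun x => numAccepted r x n) = (fun b : ℕ → ℕ => b n) ∘ history r n := by
    funext x
    simp [history]
  rw [h]
  exact (measurable_pi_apply n).comp (comap_measurable _)

lemma measurable_comp_swap (i j : ℕ) :
    Measurable (fun x : ℕ → ℝ => x ∘ Equiv.swap i j) :=
  measurable_pi_iff.2 fun _ => measurable_pi_apply _

lemma measurableSet_injective : MeasurableSet {x : ℕ → ℝ | Function.Injective x} := by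
  have : {x : ℕ → ℝ | Function.Injective x} =
      ⋂ i : ℕ, ⋂ j : ℕ, {x | x i = x j → i = j} := by
    ext x
    simp [Function.Injective]
  rw [this]
  refine MeasurableSet.iInter fun i => MeasurableSet.iInter fun j => ?_
  by_cases hij : i = j
  · simp [hij]
  · have h : {x : ℕ → ℝ | x i = x j → i = j} = {x | x i = x j}ᶜ := by
      ext x
      simp [hij]
    rw [h]
    exact (measurableSet_eq_fun (measurable_pi_apply i) (measurable_pi_apply j)).compl

namespace IsExchangeableLaw

variable {Q : Measure (ℕ → ℝ)} {r : ℕ → ℕ}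

/-- Both events are split according to the candidate `j` who holds the other of the two adjacent
ranks. Transposing `j` and `n + 1` preserves `Q` and the history, and matches the pieces. -/
lemma measure_inter_rank_eq_succ (hQ : IsExchangeableLaw Q) (hr : IsRankThreshold r) {n k : ℕ}
    (hk : k < n) {A : Set (ℕ → ℝ)} (hA : MeasurableSet[historyFiltration hr n] A) :
    Q (A ∩ {x | rankAmong x (n + 1) (n + 1) = k}) =
      Q (A ∩ {x | rankAmong x (n + 1) (n + 1) = k + 1}) := by
  obtain ⟨S, hS, rfl⟩ := hA
  have hSm : MeasurableSet (history r n ⁻¹' S) := measurable_history hr n hS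
  let D : Set (ℕ → ℝ) := {x | Function.Injective x}
  have hD : MeasurableSet D := measurableSet_injective
  have hDae : ∀ B : Set (ℕ → ℝ), Q B = Q (B ∩ D) := fun B =>
    measure_congr (by
      filter_upwards [hQ.ae_injective] with x hx
      simp only [eq_iff_iff]
      exact ⟨fun h => ⟨h, hx⟩, fun h => h.1⟩)
  let T : ℕ → ℕ → ℕ → Set (ℕ → ℝ) := fun a b j =>
    history r n ⁻¹' S ∩ D ∩ {x | rankAmong x (n + 1) (n + 1) = a} ∩
      {x | rankAmong x (n + 1) j = b}
  have hT : ∀ a b j, MeasurableSet (T a b j) := fun a b j =>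
    ((hSm.inter hD).inter (measurable_rankAmong _ _ (measurableSet_singleton a))).inter
      (measurable_rankAmong _ _ (measurableSet_singleton b))
  -- Without ties exactly one candidate has rank `b`, and she is not `n + 1` because `a ≠ b`.
  have hsum : ∀ a b, a < n + 1 → b < n + 1 → a ≠ b →
      Q (history r n ⁻¹' S ∩ {x | rankAmong x (n + 1) (n + 1) = a}) =
        ∑ j ∈ Finset.Icc 1 n, Q (T a b j) := by
    intro a b ha hb hab
    rw [← measure_biUnion_finset _ fun j _ => hT a b j, hDae]
    · congr 1
      ext x
      simp only [Set.mem_inter_iff, Set.mem_iUnion, T, Set.mem_ofPred_eq, exists_prop]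
      constructor
      · rintro ⟨⟨h1, h2⟩, h3⟩
        obtain ⟨j, hj, hjb⟩ := exists_rankAmong_eq h3 hb
        refine ⟨j, ?_, ⟨⟨h1, h3⟩, h2⟩, hjb⟩
        have : j ≠ n + 1 := by
          rintro rfl
          omega
        simp only [Finset.mem_Icc] at hj ⊢
        omega
      · rintro ⟨j, _, ⟨⟨h1, h3⟩, h2⟩, _⟩
        exact ⟨⟨h1, h2⟩, h3⟩
    · intro i hi j hj hij
      refine Set.disjoint_left.2 fun x hx hx' => hij ?_
      have hsub : ∀ i ∈ Finset.Icc 1 n, i ∈ Finset.Icc 1 (n + 1) := fun i hi => by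
        simp only [Finset.mem_Icc] at hi ⊢
        omega
      exact rankAmong_injOn hx.1.1.2 (n + 1) (hsub i hi) (hsub j hj) (hx.2.trans hx'.2.symm)
  rw [hsum k (k + 1) (by omega) (by omega) (by omega),
    hsum (k + 1) k (by omega) (by omega) (by omega)]
  refine Finset.sum_congr rfl fun j hj => ?_
  conv_rhs => rw [← hQ.map_swap j (n + 1)]
  rw [Measure.map_apply (measurable_comp_swap _ _) (hT _ _ _)]
  congr 1
  ext x
  have hτ : ∀ i, Equiv.swap j (n + 1) i ∈ Finset.Icc 1 (n + 1) ↔ i ∈ Finset.Icc 1 (n + 1) := by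
    intro i
    simp only [Finset.mem_Icc] at hj ⊢
    rw [Equiv.swap_apply_def]
    split_ifs <;> omega
  have hinj : Function.Injective (x ∘ Equiv.swap j (n + 1)) ↔ Function.Injective x :=
    Equiv.injective_comp _ _
  have hcongr : Function.Injective x →
      (rankAmong x (n + 1) j = rankAmong x (n + 1) (n + 1) + 1 ∨
        rankAmong x (n + 1) (n + 1) = rankAmong x (n + 1) j + 1) →
      history r n (x ∘ Equiv.swap j (n + 1)) = history r n x := fun hx hadj =>
    funext fun i => numAccepted_comp_swap hr hx hj hadj (min_le_right _ _)
  simp only [T, D, Set.mem_inter_iff, Set.mem_preimage, Set.mem_ofPred_eq, hinj,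
    rankAmong_comp x _ _ hτ, Equiv.swap_apply_right, Equiv.swap_apply_left]
  constructor
  · rintro ⟨⟨⟨h1, h2⟩, h3⟩, h4⟩
    refine ⟨⟨⟨?_, h2⟩, h4⟩, h3⟩
    rwa [hcongr h2 (by omega)]
  · rintro ⟨⟨⟨h1, h2⟩, h4⟩, h3⟩
    refine ⟨⟨⟨?_, h2⟩, h3⟩, h4⟩
    rwa [hcongr h2 (by omega)] at h1

/-- The `n + 1` possible ranks are equally likely on `A` and exhaust it. -/
lemma measureReal_inter_rank_lt (hQ : IsExchangeableLaw Q) [IsProbabilityMeasure Q]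
    (hr : IsRankThreshold r) {n c : ℕ}
    (hc : c ≤ n + 1) {A : Set (ℕ → ℝ)} (hA : MeasurableSet[historyFiltration hr n] A) :
    Q.real (A ∩ {x | rankAmong x (n + 1) (n + 1) < c}) = c / (n + 1) * Q.real A := by
  have hAm : MeasurableSet A := (historyFiltration hr).le n A hA
  have h0 : ∀ k < n + 1, Q.real (A ∩ {x | rankAmong x (n + 1) (n + 1) = k}) =
      Q.real (A ∩ {x | rankAmong x (n + 1) (n + 1) = 0}) := by
    intro k hk
    induction k with
    | zero => rfl
    | succ k ih =>
      rw [← ih (by omega), measureReal_def, measureReal_def,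
        ← hQ.measure_inter_rank_eq_succ hr (k := k) (by omega) hA]
  have hlt : ∀ c ≤ n + 1, Q.real (A ∩ {x | rankAmong x (n + 1) (n + 1) < c}) =
      c * Q.real (A ∩ {x | rankAmong x (n + 1) (n + 1) = 0}) := by
    intro c hc
    have : A ∩ {x | rankAmong x (n + 1) (n + 1) < c} =
        ⋃ k ∈ Finset.range c, A ∩ {x | rankAmong x (n + 1) (n + 1) = k} := by
      ext x
      simp
    rw [this, measureReal_biUnion_finset, Finset.sum_congr rfl fun k hk =>
      h0 k ((Finset.mem_range.1 hk).trans_le hc)]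
    · simp
    · intro i _ j _ hij
      refine Set.disjoint_left.2 fun x hx hx' => hij (hx.2.symm.trans hx'.2)
    · exact fun k _ => hAm.inter (measurable_rankAmong _ _ (measurableSet_singleton k))
  have huniv : Q.real (A ∩ {x | rankAmong x (n + 1) (n + 1) < n + 1}) = Q.real A := by
    congr 1
    refine Set.inter_eq_left.2 fun x _ => rankAmong_lt_card (by simp)
  have h1 := hlt (n + 1) le_rfl
  rw [huniv] at h1
  rw [hlt c hc, h1]
  push_cast
  field_simp

lemma integrable_comp_numAccepted [IsProbabilityMeasure Q] (hr : IsRankThreshold r) (g : ℕ → ℝ)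
    (n : ℕ) : Integrable (fun x => g (numAccepted r x n)) Q := by
  refine Integrable.of_bound (C := ∑ m ∈ Finset.range (n + 1), |g m|)
    ((measurable_from_nat (f := g)).comp (measurable_numAccepted hr n)).aestronglyMeasurable
    (Eventually.of_forall fun x => ?_)
  exact Finset.single_le_sum (f := fun m => |g m|) (fun _ _ => abs_nonneg _)
    (Finset.mem_range.2 (Nat.lt_succ_of_le (numAccepted_le hr x n)))

/-- The Markov transition: on `M_n = m`, a jump has conditional probability `r(m)/(n+1)`. The bound
`r(m) ≤ n + 1` for `m ≤ n` makes this legitimate. -/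
lemma setIntegral_numAccepted_succ (hQ : IsExchangeableLaw Q) [IsProbabilityMeasure Q]
    (hr : IsRankThreshold r) (g : ℕ → ℝ) (n : ℕ) {A : Set (ℕ → ℝ)}
    (hA : MeasurableSet[historyFiltration hr n] A) :
    ∫ x in A, g (numAccepted r x (n + 1)) ∂Q =
      ∫ x in A, (g (numAccepted r x n) + r (numAccepted r x n) / (n + 1) *
        (g (numAccepted r x n + 1) - g (numAccepted r x n))) ∂Q := by
  have hAm : MeasurableSet A := (historyFiltration hr).le n A hA
  let B : ℕ → Set (ℕ → ℝ) := fun m => A ∩ {x | numAccepted r x n = m}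
  have hB : ∀ m, MeasurableSet[historyFiltration hr n] (B m) := fun m =>
    @MeasurableSet.inter _ (historyFiltration hr n) _ _ hA
      (measurable_numAccepted_historyFiltration hr n (measurableSet_singleton m))
  have hBm : ∀ m, MeasurableSet (B m) := fun m => (historyFiltration hr).le n _ (hB m)
  have hU : A = ⋃ m ∈ Finset.range (n + 1), B m := by
    ext x
    simp only [B, Set.mem_iUnion, Set.mem_inter_iff, Set.mem_ofPred_eq, exists_prop,
      Finset.mem_range]
    exact ⟨fun h => ⟨_, Nat.lt_succ_of_le (numAccepted_le hr x n), h, rfl⟩,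
      fun ⟨_, _, h, _⟩ => h⟩
  have hdisj : Set.PairwiseDisjoint (Finset.range (n + 1) : Set ℕ) B := by
    intro i _ j _ hij
    exact Set.disjoint_left.2 fun x hx hx' => hij (hx.2.symm.trans hx'.2)
  rw [hU, integral_biUnion_finset _ (fun m _ => hBm m) hdisj
      fun m _ => (integrable_comp_numAccepted hr g (n + 1)).integrableOn,
    integral_biUnion_finset _ (fun m _ => hBm m) hdisj fun m _ => (integrable_comp_numAccepted hr
      (fun k => g k + r k / (n + 1) * (g (k + 1) - g k)) n).integrableOn]
  refine Finset.sum_congr rfl fun m hm => ?_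
  have hmn : r m ≤ n + 1 := by
    have := hr.le_succ m
    have := Finset.mem_range.1 hm
    omega
  have hRm : MeasurableSet {x : ℕ → ℝ | rankAmong x (n + 1) (n + 1) < r m} :=
    measurable_rankAmong _ _ (measurableSet_Iio (a := r m))
  have e1 : ∫ x in B m, g (numAccepted r x (n + 1)) ∂Q = ∫ x in B m, (g m +
      {x : ℕ → ℝ | rankAmong x (n + 1) (n + 1) < r m}.indicator
        (fun _ => g (m + 1) - g m) x) ∂Q := by
    refine setIntegral_congr_fun (hBm m) fun x hx => ?_
    have hx2 : numAccepted r x n = m := hx.2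
    simp only [numAccepted_succ hr, hx2, Set.indicator_apply, Set.mem_ofPred_eq]
    split_ifs <;> simp
  have e2 : ∫ x in B m, (g (numAccepted r x n) + r (numAccepted r x n) / (n + 1) *
        (g (numAccepted r x n + 1) - g (numAccepted r x n))) ∂Q =
      ∫ x in B m, (g m + r m / (n + 1) * (g (m + 1) - g m)) ∂Q := by
    refine setIntegral_congr_fun (hBm m) fun x hx => ?_
    have hx2 : numAccepted r x n = m := hx.2
    simp only [hx2]
  rw [e1, e2, integral_add (integrable_const _) ((integrable_const _).indicator hRm),
    setIntegral_const, setIntegral_const, setIntegral_indicator hRm, setIntegral_const,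
    hQ.measureReal_inter_rank_lt hr hmn (hB m)]
  simp only [smul_eq_mul]
  ring

/-! ### The product martingale. -/

/-- The increment of the product at `m` is `t/r(m)` times its value, so the jump rate `r(m)/(n+1)`
cancels and a deterministic factor remains. -/
lemma setIntegral_birthProd_succ (hQ : IsExchangeableLaw Q) [IsProbabilityMeasure Q]
    (hr : IsRankThreshold r) (t : ℝ) (n : ℕ) {A : Set (ℕ → ℝ)}
    (hA : MeasurableSet[historyFiltration hr n] A) :
    ∫ x in A, birthProd r t (numAccepted r x (n + 1)) ∂Q =
      (1 + t / ((n + 1 : ℕ) : ℝ)) * ∫ x in A, birthProd r t (numAccepted r x n) ∂Q := by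
  rw [hQ.setIntegral_numAccepted_succ hr (birthProd r t) n hA, ← integral_const_mul]
  congr 1
  funext x
  have := hr.cast_pos (numAccepted r x n)
  rw [birthProd_succ]
  push_cast
  field_simp
  ring

theorem integral_birthProd (hQ : IsExchangeableLaw Q) [IsProbabilityMeasure Q]
    (hr : IsRankThreshold r) (t : ℝ) (n : ℕ) :
    ∫ x, birthProd r t (numAccepted r x n) ∂Q = birthProd (fun k => k + 1) t n := by
  induction n with
  | zero => simp [numAccepted_zero, birthProd]
  | succ n ih =>
    have := hQ.setIntegral_birthProd_succ hr t n (A := Set.univ) MeasurableSet.univ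
    rw [setIntegral_univ, setIntegral_univ, ih] at this
    rw [this, birthProd_succ, mul_comm]

lemma birthProd_succ_one (n : ℕ) : birthProd (fun k => k + 1) 1 n = n + 1 := by
  induction n with
  | zero => simp [birthProd]
  | succ n ih =>
    rw [birthProd_succ, ih]
    push_cast
    field_simp

lemma martingale_birthProd (hQ : IsExchangeableLaw Q) [IsProbabilityMeasure Q]
    (hr : IsRankThreshold r) :
    Martingale (fun (n : ℕ) x => birthProd r 1 (numAccepted r x n) / ((n : ℝ) + 1))
      (historyFiltration hr) Q := by
  refine martingale_of_setIntegral_eq_succ (fun n => Measurable.stronglyMeasurable ?_)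
    (fun n => (integrable_comp_numAccepted hr (birthProd r 1) n).div_const _) fun n A hA => ?_
  · exact ((measurable_from_nat (f := birthProd r 1)).comp
      (measurable_numAccepted_historyFiltration hr n)).div_const _
  · rw [integral_div, integral_div, hQ.setIntegral_birthProd_succ hr 1 n hA]
    push_cast
    field_simp

lemma exists_tendsto_birthProd (hQ : IsExchangeableLaw Q) [IsProbabilityMeasure Q]
    (hr : IsRankThreshold r) :
    ∃ G : (ℕ → ℝ) → ℝ, Measurable G ∧ ∀ᵐ x ∂Q, Tendsto (fun n : ℕ =>
      birthProd r 1 (numAccepted r x n) / ((n : ℝ) + 1)) atTop (𝓝 (G x)) := by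
  have hM := hQ.martingale_birthProd hr
  refine ⟨_, ?_, hM.submartingale.ae_tendsto_limitProcess (R := 1) fun n => ?_⟩
  · exact Filtration.stronglyMeasurable_limit_process'.measurable
  · have hpos : ∀ x, 0 ≤ birthProd r 1 (numAccepted r x n) / ((n : ℝ) + 1) := fun x =>
      div_nonneg (birthProd_pos hr (by norm_num) _).le (by positivity)
    rw [eLpNorm_one_eq_lintegral_enorm, lintegral_congr fun x => Real.enorm_of_nonneg (hpos x),
      ← ofReal_integral_eq_lintegral_ofReal (hM.integrable n) (ae_of_all _ hpos), integral_div,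
      hQ.integral_birthProd hr, birthProd_succ_one, div_self (by positivity)]
    simp

end IsExchangeableLaw

/-- The law is an infinite power of `μ`, hence invariant under permutations of coordinates; ties are
null because an atomless `μ` gives the diagonal measure zero under `μ.prod μ`. -/
lemma isExchangeableLaw_map {Ω : Type*} [MeasurableSpace Ω] {P : Measure Ω}
    [IsProbabilityMeasure P] {μ : Measure ℝ} [NullSingletonClass μ] {X : ℕ → Ω → ℝ}
    (hX : ∀ n, Measurable (X n)) (hind : iIndepFun X P) (hlaw : ∀ n, P.map (X n) = μ) :
    IsExchangeableLaw (P.map (fun ω i => X i ω)) := by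
  have hXm : Measurable (fun ω i => X i ω) := measurable_pi_iff.2 hX
  have hμ : IsProbabilityMeasure μ := by
    rw [← hlaw 0]
    exact Measure.isProbabilityMeasure_map (hX 0).aemeasurable
  refine ⟨fun i j => ?_, ?_⟩
  · have h1 := (hind.precomp (Equiv.swap i j).injective).map_fun_eq_infinitePi_map
      fun k => hX (Equiv.swap i j k)
    have h2 := hind.map_fun_eq_infinitePi_map hX
    simp only [hlaw] at h1 h2
    rw [Measure.map_map (measurable_comp_swap i j) hXm, h2]
    exact h1
  · rw [ae_map_iff hXm.aemeasurable measurableSet_injective]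
    have h : ∀ i j, i ≠ j → ∀ᵐ ω ∂P, X i ω ≠ X j ω := by
      intro i j hij
      have h1 := (indepFun_iff_map_prod_eq_prod_map_map (hX i).aemeasurable
        (hX j).aemeasurable).1 (hind.indepFun hij)
      have hdiag : MeasurableSet {p : ℝ × ℝ | p.1 = p.2} :=
        measurableSet_eq_fun measurable_fst measurable_snd
      have h2 : (μ.prod μ) {p : ℝ × ℝ | p.1 = p.2} = 0 := by
        rw [Measure.measure_prod_null hdiag]
        refine Eventually.of_forall fun x => ?_
        have : Prod.mk x ⁻¹' {p : ℝ × ℝ | p.1 = p.2} = {x} := by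
          ext y
          simp [eq_comm]
        show μ (Prod.mk x ⁻¹' _) = 0
        rw [this, measure_singleton]
      rw [hlaw, hlaw] at h1
      rw [← h1, Measure.map_apply ((hX i).prodMk (hX j)) hdiag] at h2
      simpa [ae_iff] using h2
    have h' : ∀ᵐ ω ∂P, ∀ i j, i ≠ j → X i ω ≠ X j ω := by
      rw [ae_all_iff]
      intro i
      rw [ae_all_iff]
      intro j
      by_cases hij : i = j
      · simp [hij]
      · filter_upwards [h i j hij] with ω hω _ using hω
    filter_upwards [h'] with ω hω i j hij
    by_contra hne
    exact hω i j hne hij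

end

end Hiring

namespace Hiring

noncomputable section

/-! ### Convergence of expectations under a second moment bound -/

/-- Vitali's theorem: an `L²` bound gives uniform integrability. Fatou's lemma supplies
integrability of the limit. -/
lemma tendsto_integral_of_integral_sq_le {Ω : Type*} [MeasurableSpace Ω] {P : Measure Ω}
    [IsProbabilityMeasure P] {Y : ℕ → Ω → ℝ} {Z : Ω → ℝ} {K : ℝ}
    (hY : ∀ n, AEStronglyMeasurable (Y n) P) (hint : ∀ n, Integrable (fun ω => Y n ω ^ 2) P)
    (hK : ∀ n, ∫ ω, Y n ω ^ 2 ∂P ≤ K)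
    (hlim : ∀ᵐ ω ∂P, Tendsto (fun n => Y n ω) atTop (𝓝 (Z ω))) :
    Integrable Z P ∧ Tendsto (fun n => ∫ ω, Y n ω ∂P) atTop (𝓝 (∫ ω, Z ω ∂P)) := by
  have hZ : AEStronglyMeasurable Z P := aestronglyMeasurable_of_tendsto_ae atTop hY hlim
  have hlint : ∀ n, ∫⁻ ω, ENNReal.ofReal (Y n ω ^ 2) ∂P ≤ ENNReal.ofReal K := fun n => by
    rw [← ofReal_integral_eq_lintegral_ofReal (hint n) (ae_of_all _ fun _ => sq_nonneg _)]
    exact ENNReal.ofReal_le_ofReal (hK n)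
  have hYi : ∀ n, Integrable (Y n) P := fun n =>
    ((memLp_two_iff_integrable_sq (hY n)).2 (hint n)).integrable one_le_two
  have hL1 : ∀ n, ∫⁻ ω, ‖Y n ω‖ₑ ∂P ≤ 1 + ENNReal.ofReal K := fun n => by
    calc ∫⁻ ω, ‖Y n ω‖ₑ ∂P ≤ ∫⁻ ω, (1 + ENNReal.ofReal (Y n ω ^ 2)) ∂P := by
          refine lintegral_mono fun ω => ?_
          rw [Real.enorm_eq_ofReal_abs, ← ENNReal.ofReal_one,
            ← ENNReal.ofReal_add zero_le_one (sq_nonneg _)]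
          refine ENNReal.ofReal_le_ofReal ?_
          rw [← sq_abs]
          nlinarith [sq_nonneg (|Y n ω| - 1)]
      _ ≤ _ := by
          rw [lintegral_add_left measurable_const]
          simpa using hlint n
  have hZi : Integrable Z P := by
    refine ⟨hZ, ?_⟩
    have h1 : ∫⁻ ω, ‖Z ω‖ₑ ∂P ≤ liminf (fun n => ∫⁻ ω, ‖Y n ω‖ₑ ∂P) atTop := by
      refine le_trans (lintegral_mono_ae ?_) (lintegral_liminf_le' fun n => (hY n).enorm)
      filter_upwards [hlim] with ω hω
      exact hω.enorm.liminf_eq.ge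
    refine (h1.trans (liminf_le_of_frequently_le' (Frequently.of_forall hL1))).trans_lt ?_
    finiteness
  refine ⟨hZi, tendsto_integral_of_L1' _ hZi.1 (Eventually.of_forall hYi) ?_⟩
  refine tendsto_Lp_finite_of_tendsto_ae le_rfl ENNReal.one_ne_top hY
    (memLp_one_iff_integrable.2 hZi) ?_ hlim
  refine unifIntegrable_of le_rfl ENNReal.one_ne_top hY fun ε hε => ?_
  -- Beyond a level `C`, `|Y| ≤ Y²/C`, so the tail is at most `K/C`; this `C` makes it at most `ε`,
  -- and the `+ 1` keeps `C` positive.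
  refine ⟨Real.toNNReal (|K| / ε + 1), fun n => ?_⟩
  have hC : 0 < |K| / ε + 1 := by positivity
  rw [eLpNorm_one_eq_lintegral_enorm]
  calc _ ≤ ∫⁻ ω, ENNReal.ofReal (|K| / ε + 1)⁻¹ * ENNReal.ofReal (Y n ω ^ 2) ∂P := by
        refine lintegral_mono fun ω => ?_
        rw [Set.indicator_apply]
        split_ifs with h
        · have h' : |K| / ε + 1 ≤ |Y n ω| := by
            have := NNReal.coe_le_coe.2 h
            rwa [Real.coe_toNNReal _ hC.le, coe_nnnorm, Real.norm_eq_abs] at this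
          rw [Real.enorm_eq_ofReal_abs, ← ENNReal.ofReal_mul (by positivity)]
          refine ENNReal.ofReal_le_ofReal ?_
          rw [inv_mul_eq_div, le_div_iff₀ hC, ← sq_abs]
          nlinarith [abs_nonneg (Y n ω)]
        · simp
    _ ≤ ENNReal.ofReal (|K| / ε + 1)⁻¹ * ENNReal.ofReal K := by
        rw [lintegral_const_mul' _ _ ENNReal.ofReal_ne_top]
        gcongr
        exact hlint n
    _ ≤ ENNReal.ofReal ε := by
        rw [← ENNReal.ofReal_mul (by positivity)]
        refine ENNReal.ofReal_le_ofReal ?_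
        rw [inv_mul_eq_div, div_le_iff₀ hC]
        have : ε * (|K| / ε + 1) = |K| + ε := by field_simp
        rw [this]
        linarith [le_abs_self K]

/-! ### Moments of the number of accepted candidates -/

namespace IsPeriodicThreshold

variable {r : ℕ → ℕ} {q ν : ℕ}

lemma tendsto_birthProd_rpow (h : IsPeriodicThreshold r q ν) {s : ℝ}
    (hs : -1 < (ν : ℝ) / q * s) :
    Tendsto (fun m : ℕ => birthProd r ((ν : ℝ) / q * s) m / (m : ℝ) ^ s) atTop
      (𝓝 (growthConst r q ν ((ν : ℝ) / q * s))) := by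
  have hq := h.q_pos
  have hν := h.nu_pos
  have := h.tendsto_birthProd hs
  have e : (ν : ℝ) / q * s * q / ν = s := by field_simp
  rwa [e] at this

/-- `φ²` grows at most like `m^(2s)`, the rate of the product with doubled parameter, whose
expectation along `M` is known exactly. -/
lemma exists_sq_le_birthProd (h : IsPeriodicThreshold r q ν) {s L : ℝ} {φ : ℕ → ℝ}
    (hs : -1 < (ν : ℝ) / q * (s * 2))
    (hφ : Tendsto (fun m : ℕ => φ m / (m : ℝ) ^ s) atTop (𝓝 L)) :
    ∃ c, 0 ≤ c ∧ ∀ m, φ m ^ 2 ≤ c * birthProd r ((ν : ℝ) / q * (s * 2)) m := by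
  have h1 := (hφ.pow 2).div (h.tendsto_birthProd_rpow hs) (h.growthConst_pos hs).ne'
  have h2 : Tendsto (fun m : ℕ => φ m ^ 2 / birthProd r ((ν : ℝ) / q * (s * 2)) m) atTop
      (𝓝 (L ^ 2 / growthConst r q ν ((ν : ℝ) / q * (s * 2)))) := by
    refine h1.congr' ?_
    filter_upwards [eventually_gt_atTop 0] with m hm
    have hm' : (0 : ℝ) < m := by exact_mod_cast hm
    have hp := birthProd_pos h.isRankThreshold hs m
    have hr1 := Real.rpow_pos_of_pos hm' s
    have e : (m : ℝ) ^ (s * 2) = ((m : ℝ) ^ s) ^ 2 := by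
      exact_mod_cast Real.rpow_mul_natCast hm'.le s 2
    simp only [Pi.div_apply]
    rw [e]
    field_simp
  obtain ⟨c, hc⟩ := h2.bddAbove_range
  refine ⟨c, ?_, fun m => ?_⟩
  · exact le_trans (div_nonneg (sq_nonneg _) (birthProd_pos h.isRankThreshold hs 0).le)
      (hc ⟨0, rfl⟩)
  · exact (div_le_iff₀ (birthProd_pos h.isRankThreshold hs m)).1 (hc ⟨m, rfl⟩)

/-- If `M_n → ∞`, the growth rate of the product is inverted. Divergence is not yet known, but if
`M` stabilizes then `g = 0` and the formula still holds, both sides being `0`. -/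
lemma tendsto_numAccepted_div (h : IsPeriodicThreshold r q ν) {x : ℕ → ℝ} {g : ℝ}
    (hg : Tendsto (fun n : ℕ => birthProd r 1 (numAccepted r x n) / ((n : ℝ) + 1)) atTop (𝓝 g)) :
    Tendsto (fun n : ℕ => (numAccepted r x n : ℝ) / (n : ℝ) ^ ((ν : ℝ) / q)) atTop
      (𝓝 ((g / growthConst r q ν 1) ^ ((ν : ℝ) / q))) := by
  have hq := h.q_pos
  have hν := h.nu_pos
  have hα : 0 < (ν : ℝ) / q := div_pos hν hq
  have hr := h.isRankThreshold
  have hC := h.growthConst_pos (t := 1) (by norm_num)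
  have hmono : Monotone (numAccepted r x) := monotone_nat_of_le_succ fun n => by
    rw [numAccepted_succ hr]
    omega
  rcases tendsto_atTop_of_monotone hmono with hM | ⟨l, hl⟩
  · have h1 := (h.tendsto_birthProd (t := 1) (by norm_num)).comp hM
    have h2 : Tendsto (fun n : ℕ => ((n : ℝ) + 1) / n) atTop (𝓝 1) := by
      have := tendsto_one_div_atTop_nhds_zero_nat (𝕜 := ℝ) |>.const_add 1
      rw [add_zero] at this
      refine this.congr' ?_
      filter_upwards [eventually_gt_atTop 0] with n hn
      have : (0 : ℝ) < n := by exact_mod_cast hn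
      field_simp
    have h3 := (hg.mul h2).div h1 hC.ne'
    rw [mul_one] at h3
    refine (h3.rpow_const (p := (ν : ℝ) / q) (Or.inr hα.le)).congr' ?_
    filter_upwards [eventually_gt_atTop 0] with n hn
    have hn' : (0 : ℝ) < n := by exact_mod_cast hn
    have hm : (0 : ℝ) < numAccepted r x n := by
      exact_mod_cast one_le_numAccepted hr x hn
    have hp := birthProd_pos hr (t := 1) (by norm_num) (numAccepted r x n)
    have hpw := Real.rpow_pos_of_pos hm (1 * q / ν)
    have e : birthProd r 1 (numAccepted r x n) / ((n : ℝ) + 1) * (((n : ℝ) + 1) / n) /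
        (birthProd r 1 (numAccepted r x n) / (numAccepted r x n : ℝ) ^ (1 * q / ν : ℝ)) =
        (numAccepted r x n : ℝ) ^ (1 * q / ν : ℝ) / n := by
      field_simp
    simp only [Pi.div_apply, Function.comp_apply]
    rw [e, Real.div_rpow hpw.le hn'.le, ← Real.rpow_mul hm.le]
    have e2 : 1 * (q : ℝ) / ν * (ν / q) = 1 := by field_simp
    rw [e2, Real.rpow_one]
  · have hev : ∀ᶠ n in atTop, numAccepted r x n = l := by
      rw [nhds_discrete] at hl
      exact tendsto_pure.1 hl
    have hn1 : Tendsto (fun n : ℕ => (n : ℝ) + 1) atTop atTop :=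
      tendsto_atTop_add_const_right _ _ tendsto_natCast_atTop_atTop
    have h0 : g = 0 := by
      refine tendsto_nhds_unique hg ((hn1.const_div_atTop (birthProd r 1 l)).congr' ?_)
      filter_upwards [hev] with n hn
      rw [hn]
    rw [h0, zero_div, Real.zero_rpow hα.ne']
    refine (((tendsto_rpow_atTop hα).comp tendsto_natCast_atTop_atTop).const_div_atTop
      (l : ℝ)).congr' ?_
    filter_upwards [hev] with n hn
    rw [hn]
    rfl

end IsPeriodicThreshold

namespace IsExchangeableLaw

variable {Q : Measure (ℕ → ℝ)} {r : ℕ → ℕ} {q ν : ℕ}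

lemma exists_integral_birthProd_le (hQ : IsExchangeableLaw Q) [IsProbabilityMeasure Q]
    (hr : IsRankThreshold r) {t : ℝ} (ht : -1 < t) :
    ∃ c, 0 ≤ c ∧ ∀ n : ℕ, (∫ x, birthProd r t (numAccepted r x n) ∂Q) / (n : ℝ) ^ t ≤ c := by
  obtain ⟨c, hc⟩ := (tendsto_birthProd_succ ht).bddAbove_range
  have h1 : ∀ n : ℕ, birthProd (fun k => k + 1) t n / (n : ℝ) ^ t ≤ c := fun n => hc ⟨n, rfl⟩
  refine ⟨c, ?_, fun n => ?_⟩
  · refine le_trans (div_nonneg ?_ (by positivity)) (h1 0)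
    exact (birthProd_pos (isPeriodicThreshold_succ le_rfl).isRankThreshold ht 0).le
  · rw [hQ.integral_birthProd hr]
    exact h1 n

lemma exists_integral_sq_le (hQ : IsExchangeableLaw Q) [IsProbabilityMeasure Q]
    (h : IsPeriodicThreshold r q ν) {s L : ℝ} {φ : ℕ → ℝ}
    (hs : -1 < (ν : ℝ) / q * (s * 2))
    (hφ : Tendsto (fun m : ℕ => φ m / (m : ℝ) ^ s) atTop (𝓝 L)) :
    ∃ K, ∀ n : ℕ, ∫ x, (φ (numAccepted r x n) / (n : ℝ) ^ ((ν : ℝ) / q * s)) ^ 2 ∂Q ≤ K := by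
  have hr := h.isRankThreshold
  obtain ⟨c, hc0, hc⟩ := h.exists_sq_le_birthProd hs hφ
  obtain ⟨c', _, hc'⟩ := hQ.exists_integral_birthProd_le hr hs
  refine ⟨c * c', fun n => ?_⟩
  have e : ((n : ℝ) ^ ((ν : ℝ) / q * s)) ^ 2 = (n : ℝ) ^ ((ν : ℝ) / q * (s * 2)) := by
    rw [← mul_assoc]
    exact_mod_cast (Real.rpow_mul_natCast n.cast_nonneg ((ν : ℝ) / q * s) 2).symm
  calc _ ≤ ∫ x, c * (birthProd r ((ν : ℝ) / q * (s * 2)) (numAccepted r x n) /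
        (n : ℝ) ^ ((ν : ℝ) / q * (s * 2))) ∂Q := by
        refine integral_mono (integrable_comp_numAccepted hr
          (fun m => (φ m / (n : ℝ) ^ ((ν : ℝ) / q * s)) ^ 2) n)
          (integrable_comp_numAccepted hr (fun m => c * (birthProd r ((ν : ℝ) / q * (s * 2)) m /
            (n : ℝ) ^ ((ν : ℝ) / q * (s * 2)))) n) fun x => ?_
        simp only [div_pow, e]
        rw [← mul_div_assoc]
        gcongr
        exact hc _
    _ ≤ _ := by
        rw [integral_const_mul, integral_div]
        exact mul_le_mul_of_nonneg_left (hc' n) hc0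

variable {W : (ℕ → ℝ) → ℝ}

/-- A negative moment of `M_n/n^α` stays bounded, so by Fatou's lemma `W` cannot vanish with
positive probability. -/
lemma ae_pos_of_tendsto (hQ : IsExchangeableLaw Q) [IsProbabilityMeasure Q]
    (h : IsPeriodicThreshold r q ν)
    (hW : ∀ᵐ x ∂Q, Tendsto (fun n : ℕ => (numAccepted r x n : ℝ) / (n : ℝ) ^ ((ν : ℝ) / q)) atTop
      (𝓝 (W x))) : ∀ᵐ x ∂Q, 0 < W x := by
  have hr := h.isRankThreshold
  have hq := h.q_pos
  have hν := h.nu_pos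
  -- With `αs = -1/4` the doubled parameter is `-1/2`, still above `-1`.
  obtain ⟨s, hs⟩ : ∃ s : ℝ, (ν : ℝ) / q * s = -(1 / 4) := ⟨-(1 / 4) * (q / ν), by field_simp⟩
  have hs0 : s < 0 := by
    by_contra hc
    have : 0 ≤ (ν : ℝ) / q * s := mul_nonneg (by positivity) (not_lt.1 hc)
    linarith
  have hφ : Tendsto (fun m : ℕ => (m : ℝ) ^ s / (m : ℝ) ^ s) atTop (𝓝 1) := by
    refine tendsto_const_nhds.congr' ?_
    filter_upwards [eventually_gt_atTop 0] with m hm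
    have hm' : (0 : ℝ) < m := by exact_mod_cast hm
    rw [div_self (Real.rpow_pos_of_pos hm' s).ne']
  obtain ⟨K, hK⟩ := hQ.exists_integral_sq_le h (s := s) (by rw [← mul_assoc, hs]; norm_num) hφ
  let Y : ℕ → (ℕ → ℝ) → ℝ := fun n x =>
    (numAccepted r x (n + 1) : ℝ) / ((n + 1 : ℕ) : ℝ) ^ ((ν : ℝ) / q)
  have hYm : ∀ n, Measurable (Y n) := fun n =>
    ((measurable_from_nat (f := fun m : ℕ => (m : ℝ))).comp
      (measurable_numAccepted hr (n + 1))).div_const _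
  have hYpos : ∀ n x, 0 < Y n x := fun n x => by
    have h1 : (0 : ℝ) < numAccepted r x (n + 1) := by
      exact_mod_cast one_le_numAccepted hr x (Nat.le_add_left 1 n)
    have h2 : (0 : ℝ) < ((n + 1 : ℕ) : ℝ) := by positivity
    positivity
  -- Powers are taken in `ENNReal`, where a negative power of `0` is `⊤`; the real power would be
  -- `0` and detect nothing. The shift to `n + 1` avoids `M_0 = 0`.
  have hbound : ∀ n, ∫⁻ x, ENNReal.ofReal (Y n x) ^ (s * 2) ∂Q ≤ ENNReal.ofReal K := by
    intro n
    have e : ∀ x, ENNReal.ofReal (Y n x) ^ (s * 2) = ENNReal.ofReal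
        (((numAccepted r x (n + 1) : ℝ) ^ s /
          ((n + 1 : ℕ) : ℝ) ^ ((ν : ℝ) / q * s)) ^ 2) := by
      intro x
      have h2 : (0 : ℝ) ≤ ((n + 1 : ℕ) : ℝ) := by positivity
      rw [ENNReal.ofReal_rpow_of_pos (hYpos n x), Real.rpow_mul h2,
        ← Real.div_rpow (Nat.cast_nonneg _) (by positivity)]
      congr 1
      exact_mod_cast Real.rpow_mul_natCast (hYpos n x).le s 2
    simp only [e]
    rw [← ofReal_integral_eq_lintegral_ofReal (integrable_comp_numAccepted hr
      (fun m => ((m : ℝ) ^ s / ((n + 1 : ℕ) : ℝ) ^ ((ν : ℝ) / q * s)) ^ 2) (n + 1))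
      (ae_of_all _ fun _ => sq_nonneg _)]
    exact ENNReal.ofReal_le_ofReal (hK (n + 1))
  have hlim : ∀ᵐ x ∂Q, Tendsto (fun n => ENNReal.ofReal (Y n x) ^ (s * 2)) atTop
      (𝓝 (ENNReal.ofReal (W x) ^ (s * 2))) := by
    filter_upwards [hW] with x hx
    exact (ENNReal.continuous_rpow_const.tendsto _).comp
      ((ENNReal.continuous_ofReal.tendsto _).comp ((tendsto_add_atTop_iff_nat 1).2 hx))
  have hfin : ∫⁻ x, liminf (fun n => ENNReal.ofReal (Y n x) ^ (s * 2)) atTop ∂Q < ⊤ := by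
    refine lt_of_le_of_lt (lintegral_liminf_le fun n => ?_)
      ((liminf_le_of_frequently_le' (Frequently.of_forall hbound)).trans_lt ENNReal.ofReal_lt_top)
    exact (ENNReal.continuous_rpow_const.measurable).comp (hYm n).ennreal_ofReal
  have hmeas : Measurable fun x => liminf (fun n => ENNReal.ofReal (Y n x) ^ (s * 2)) atTop :=
    Measurable.liminf fun n =>
      (ENNReal.continuous_rpow_const.measurable).comp (hYm n).ennreal_ofReal
  filter_upwards [ae_lt_top hmeas hfin.ne, hlim] with x hx hx2
  rw [hx2.liminf_eq] at hx
  by_contra hc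
  rw [ENNReal.ofReal_of_nonpos (not_lt.1 hc), ENNReal.zero_rpow_of_neg (by linarith)] at hx
  exact lt_irrefl _ hx

/-- Positivity of `W` forces `M_n → ∞`, so `φ(M_n)/n^(αs)` is `φ(M_n)/M_n^s`, tending to `L`, times
`(M_n/n^α)^s`. Used with `φ = m^s` for the moments and with `φ` the product for their value. -/
lemma integral_comp_numAccepted_tendsto (hQ : IsExchangeableLaw Q) [IsProbabilityMeasure Q]
    (h : IsPeriodicThreshold r q ν)
    (hW : ∀ᵐ x ∂Q, Tendsto (fun n : ℕ => (numAccepted r x n : ℝ) / (n : ℝ) ^ ((ν : ℝ) / q)) atTop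
      (𝓝 (W x))) {s L : ℝ} {φ : ℕ → ℝ} (hs : -1 < (ν : ℝ) / q * (s * 2))
    (hφ : Tendsto (fun m : ℕ => φ m / (m : ℝ) ^ s) atTop (𝓝 L)) :
    Integrable (fun x => L * W x ^ s) Q ∧
      Tendsto (fun n : ℕ => (∫ x, φ (numAccepted r x n) ∂Q) / (n : ℝ) ^ ((ν : ℝ) / q * s)) atTop
        (𝓝 (L * ∫ x, W x ^ s ∂Q)) := by
  have hr := h.isRankThreshold
  have hα : 0 < (ν : ℝ) / q := div_pos h.nu_pos h.q_pos
  obtain ⟨K, hK⟩ := hQ.exists_integral_sq_le h hs hφ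
  have key := tendsto_integral_of_integral_sq_le (P := Q)
    (Y := fun n x => φ (numAccepted r x n) / (n : ℝ) ^ ((ν : ℝ) / q * s))
    (Z := fun x => L * W x ^ s)
    (fun n => (integrable_comp_numAccepted hr
      (fun m => φ m / (n : ℝ) ^ ((ν : ℝ) / q * s)) n).aestronglyMeasurable)
    (fun n => integrable_comp_numAccepted hr
      (fun m => (φ m / (n : ℝ) ^ ((ν : ℝ) / q * s)) ^ 2) n) hK ?_
  · simpa only [integral_const_mul, integral_div] using key
  · filter_upwards [hW, hQ.ae_pos_of_tendsto h hW] with x hx hpos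
    have hM : Tendsto (fun n => numAccepted r x n) atTop atTop := by
      rw [← tendsto_natCast_atTop_iff (R := ℝ)]
      refine (hx.pos_mul_atTop hpos
        ((tendsto_rpow_atTop hα).comp tendsto_natCast_atTop_atTop)).congr' ?_
      filter_upwards [eventually_gt_atTop 0] with n hn
      have hn' : (0 : ℝ) < n := by exact_mod_cast hn
      exact div_mul_cancel₀ _ (Real.rpow_pos_of_pos hn' _).ne'
    refine ((hφ.comp hM).mul (hx.rpow_const (p := s) (Or.inl hpos.ne'))).congr' ?_
    filter_upwards [eventually_gt_atTop 0] with n hn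
    have hn' : (0 : ℝ) < n := by exact_mod_cast hn
    have hm : (0 : ℝ) < numAccepted r x n := by
      exact_mod_cast one_le_numAccepted hr x hn
    have h1 := Real.rpow_pos_of_pos hm s
    have h2 := Real.rpow_pos_of_pos hn' ((ν : ℝ) / q * s)
    simp only [Function.comp_apply]
    rw [Real.div_rpow hm.le (by positivity), ← Real.rpow_mul hn'.le]
    field_simp

theorem tendsto_moment (hQ : IsExchangeableLaw Q) [IsProbabilityMeasure Q]
    (h : IsPeriodicThreshold r q ν)
    (hW : ∀ᵐ x ∂Q, Tendsto (fun n : ℕ => (numAccepted r x n : ℝ) / (n : ℝ) ^ ((ν : ℝ) / q)) atTop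
      (𝓝 (W x))) {s : ℝ} (hs : -1 < (ν : ℝ) / q * (s * 2)) :
    Integrable (fun x => W x ^ s) Q ∧
      Tendsto (fun n : ℕ => (∫ x, (numAccepted r x n : ℝ) ^ s ∂Q) / (n : ℝ) ^ ((ν : ℝ) / q * s))
        atTop (𝓝 (∫ x, W x ^ s ∂Q)) := by
  have hφ : Tendsto (fun m : ℕ => (m : ℝ) ^ s / (m : ℝ) ^ s) atTop (𝓝 1) := by
    refine tendsto_const_nhds.congr' ?_
    filter_upwards [eventually_gt_atTop 0] with m hm
    have hm' : (0 : ℝ) < m := by exact_mod_cast hm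
    rw [div_self (Real.rpow_pos_of_pos hm' s).ne']
  simpa using hQ.integral_comp_numAccepted_tendsto h hW hs hφ

theorem integral_limit_rpow (hQ : IsExchangeableLaw Q) [IsProbabilityMeasure Q]
    (h : IsPeriodicThreshold r q ν)
    (hW : ∀ᵐ x ∂Q, Tendsto (fun n : ℕ => (numAccepted r x n : ℝ) / (n : ℝ) ^ ((ν : ℝ) / q)) atTop
      (𝓝 (W x))) {s : ℝ} (hs : -1 < (ν : ℝ) / q * (s * 2)) :
    ∫ x, W x ^ s ∂Q = 1 / Real.Gamma ((ν : ℝ) / q * s + 1) /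
      growthConst r q ν ((ν : ℝ) / q * s) := by
  have hs1 : -1 < (ν : ℝ) / q * s := by
    rw [← mul_assoc] at hs
    linarith
  have h1 := (hQ.integral_comp_numAccepted_tendsto h hW hs (h.tendsto_birthProd_rpow hs1)).2
  simp only [hQ.integral_birthProd h.isRankThreshold] at h1
  rw [eq_div_iff (h.growthConst_pos hs1).ne', mul_comm]
  exact tendsto_nhds_unique h1 (tendsto_birthProd_succ hs1)

end IsExchangeableLaw

end

end Hiring

namespace Hiring

noncomputable section

/-! ### Exponential variables -/

lemma expMeasure_one_eq :
    expMeasure 1 = (volume.restrict (Set.Ioi (0 : ℝ))).withDensity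
      (fun x => ENNReal.ofReal (Real.exp (-x))) := by
  rw [← withDensity_indicator measurableSet_Ioi, expMeasure, gammaMeasure]
  refine withDensity_congr_ae ?_
  have h0 : ∀ᵐ x : ℝ, x ≠ 0 := by simp [ae_iff]
  filter_upwards [h0] with x hx
  change exponentialPDF 1 x = _
  rw [exponentialPDF_eq, Set.indicator_apply]
  rcases lt_or_gt_of_ne hx with h | h
  · rw [if_neg (not_le.2 h), if_neg (by simpa using h.le), ENNReal.ofReal_zero]
  · rw [if_pos h.le, if_pos (by simpa using h)]
    simp

lemma integrable_expMeasure_one_iff (g : ℝ → ℝ) :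
    Integrable g (expMeasure 1) ↔ IntegrableOn (fun x => Real.exp (-x) * g x) (Set.Ioi 0) := by
  rw [expMeasure_one_eq, integrable_withDensity_iff_integrable_smul'
    (by fun_prop) (ae_of_all _ fun _ => ENNReal.ofReal_lt_top)]
  simp only [ENNReal.toReal_ofReal (Real.exp_pos _).le, smul_eq_mul, IntegrableOn]

lemma integral_expMeasure_one (g : ℝ → ℝ) :
    ∫ x, g x ∂(expMeasure 1) = ∫ x in Set.Ioi (0 : ℝ), Real.exp (-x) * g x := by
  rw [expMeasure_one_eq, integral_withDensity_eq_integral_toReal_smul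
    (by fun_prop) (ae_of_all _ fun _ => ENNReal.ofReal_lt_top)]
  simp only [ENNReal.toReal_ofReal (Real.exp_pos _).le, smul_eq_mul]

lemma integrable_id_expMeasure_one : Integrable (fun x : ℝ => x) (expMeasure 1) := by
  rw [integrable_expMeasure_one_iff]
  have := Real.GammaIntegral_convergent (s := 2) two_pos
  refine this.congr_fun (fun x _ => ?_) measurableSet_Ioi
  norm_num

lemma integral_id_expMeasure_one : ∫ x : ℝ, x ∂(expMeasure 1) = 1 := by
  rw [integral_expMeasure_one, ← Real.Gamma_two, Real.Gamma_eq_integral two_pos]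
  refine setIntegral_congr_fun measurableSet_Ioi fun x _ => ?_
  norm_num

lemma integrable_exp_mul_expMeasure_one {a : ℝ} (ha : a < 1) :
    Integrable (fun x => Real.exp (a * x)) (expMeasure 1) := by
  rw [integrable_expMeasure_one_iff]
  refine (integrableOn_exp_mul_Ioi (a := a - 1) (by linarith) 0).congr_fun (fun x _ => ?_)
    measurableSet_Ioi
  simp only [← Real.exp_add]
  ring_nf

lemma integral_exp_mul_expMeasure_one {a : ℝ} (ha : a < 1) :
    ∫ x, Real.exp (a * x) ∂(expMeasure 1) = 1 / (1 - a) := by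
  rw [integral_expMeasure_one]
  have h1 : 1 - a ≠ 0 := by linarith
  have h2 : a - 1 ≠ 0 := by linarith
  have h := integral_exp_mul_Ioi (a := a - 1) (by linarith) 0
  have e : ∀ x : ℝ, Real.exp (-x) * Real.exp (a * x) = Real.exp ((a - 1) * x) := fun x => by
    rw [← Real.exp_add]
    ring_nf
  simp only [e]
  rw [h, mul_zero, Real.exp_zero]
  field_simp
  ring

/-! ### The deterministic part of the series `Z` -/

lemma delta_div_nonneg (r : ℕ → ℕ) (k : ℕ) : 0 ≤ delta r k / r k := by
  unfold delta
  split_ifs <;> positivity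

lemma delta_div_le_one {r : ℕ → ℕ} (hr : IsRankThreshold r) (k : ℕ) : delta r k / r k ≤ 1 := by
  rw [div_le_one (hr.cast_pos k)]
  refine le_trans ?_ (hr.one_le_cast k)
  unfold delta
  split_ifs <;> norm_num

lemma one_add_mul_delta_pos {r : ℕ → ℕ} (hr : IsRankThreshold r) {t : ℝ} (ht : -1 < t) (k : ℕ) :
    0 < 1 + t * (delta r k / r k) := by
  have h0 := delta_div_nonneg r k
  have h1 := delta_div_le_one hr k
  generalize delta r k / r k = c at *
  rcases le_total 0 t with h | h
  · positivity
  · nlinarith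

/-- Each value `1, …, r(m)` is reached by a first visit, and these factors form the product for `k +
1`; the repeated visits are the indices with `δ_k = 1`. -/
lemma birthProd_eq_mul {r : ℕ → ℕ} (hr : IsRankThreshold r) (t : ℝ) (m : ℕ) :
    birthProd r t (m + 1) = birthProd (fun k => k + 1) t (r m) *
      ∏ k ∈ Finset.Icc 1 m, (1 + t * (delta r k / r k)) := by
  induction m with
  | zero => simp [birthProd, hr.1]
  | succ m ih =>
    rw [birthProd_succ, ih, Finset.prod_Icc_succ_top (by omega)]
    obtain ⟨h1, h2⟩ := hr.2 m
    rcases h1.eq_or_lt with h | h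
    · rw [delta, if_pos (by rw [Nat.add_sub_cancel, h]), h]
      ring
    · have e : r (m + 1) = r m + 1 := by omega
      rw [delta, if_neg (by rw [Nat.add_sub_cancel]; omega), e, birthProd_succ]
      ring

lemma sum_inv_eq_harmonic {r : ℕ → ℕ} (hr : IsRankThreshold r) (m : ℕ) :
    ∑ k ∈ Finset.range (m + 1), 1 / (r k : ℝ) =
      (harmonic (r m) : ℝ) + ∑ k ∈ Finset.Icc 1 m, delta r k / r k := by
  induction m with
  | zero => simp [hr.1, harmonic]
  | succ m ih =>
    rw [Finset.sum_range_succ, ih, Finset.sum_Icc_succ_top (by omega)]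
    obtain ⟨h1, h2⟩ := hr.2 m
    rcases h1.eq_or_lt with h | h
    · rw [delta, if_pos (by rw [Nat.add_sub_cancel, h]), h]
      ring
    · have e : r (m + 1) = r m + 1 := by omega
      rw [delta, if_neg (by rw [Nat.add_sub_cancel]; omega), e, harmonic_succ]
      push_cast
      ring

namespace IsPeriodicThreshold

variable {r : ℕ → ℕ} {q ν : ℕ}

lemma tendsto_atTop (h : IsPeriodicThreshold r q ν) : Tendsto r atTop atTop := by
  have hα : 0 < (ν : ℝ) / q := div_pos h.nu_pos h.q_pos
  rw [← tendsto_natCast_atTop_iff (R := ℝ)]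
  refine tendsto_atTop_mono (f := fun m : ℕ => (ν : ℝ) / q * m + (-(q + 1))) (fun m => ?_)
    (tendsto_atTop_add_const_right _ _ (tendsto_natCast_atTop_atTop.const_mul_atTop hα))
  have := (abs_le.1 (h.abs_sub_le m)).1
  linarith

/-- This limit is what fixes the constant in `limitW`: it balances the normalizations `r(m)^(αs)`
and `(m+1)^s` of the two products against the centering of `Z`. -/
lemma tendsto_log_correction (h : IsPeriodicThreshold r q ν) :
    Tendsto (fun m : ℕ => ((ν : ℝ) / q - 1) * Real.eulerMascheroniConstant
        - (ν : ℝ) / q * rho r ((ν : ℝ) / q) - (ν : ℝ) / q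
        + (ν : ℝ) / q * ∑ k ∈ Finset.Icc 1 m, delta r k / r k
        + (ν : ℝ) / q * Real.log (r m) - Real.log (m + 1)) atTop (𝓝 0) := by
  have hq := h.q_pos
  have hν := h.nu_pos
  have h1 := h.tendsto_sum_inv.const_mul ((ν : ℝ) / q)
  have h2 := (Real.tendsto_harmonic_sub_log.comp h.tendsto_atTop).const_mul ((ν : ℝ) / q)
  have h3 := (h1.sub h2).const_add (((ν : ℝ) / q - 1) * Real.eulerMascheroniConstant
        - (ν : ℝ) / q * rho r ((ν : ℝ) / q) - (ν : ℝ) / q)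
  have e : ((ν : ℝ) / q - 1) * Real.eulerMascheroniConstant
        - (ν : ℝ) / q * rho r ((ν : ℝ) / q) - (ν : ℝ) / q +
        ((ν : ℝ) / q * (1 + rho r ((ν : ℝ) / q) + q / ν * Real.eulerMascheroniConstant) -
          (ν : ℝ) / q * Real.eulerMascheroniConstant) = 0 := by
    field_simp
    ring
  rw [e] at h3
  refine h3.congr fun m => ?_
  have e2 : (ν : ℝ) / q * ((q : ℝ) / ν * Real.log (m + 1)) = Real.log (m + 1) := by
    field_simp
  simp only [Function.comp_apply]
  rw [sum_inv_eq_harmonic h.isRankThreshold, mul_sub, e2]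
  ring

/-- The left side is the moment of order `s` of the representation with `Z` cut off at `m`; the
right side is the formula for `E W^s`. -/
lemma tendsto_exp_div_prod (h : IsPeriodicThreshold r q ν) {s : ℝ} (hs : -1 < (ν : ℝ) / q * s) :
    Tendsto (fun m : ℕ => Real.exp (s * (((ν : ℝ) / q - 1) * Real.eulerMascheroniConstant
        - (ν : ℝ) / q * rho r ((ν : ℝ) / q) - (ν : ℝ) / q)) *
      (Real.exp ((ν : ℝ) / q * s * ∑ k ∈ Finset.Icc 1 m, delta r k / r k) /
        ∏ k ∈ Finset.Icc 1 m, (1 + (ν : ℝ) / q * s * (delta r k / r k)))) atTop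
      (𝓝 (1 / Real.Gamma ((ν : ℝ) / q * s + 1) / growthConst r q ν ((ν : ℝ) / q * s))) := by
  have hr := h.isRankThreshold
  have h1 := (tendsto_birthProd_succ hs).comp h.tendsto_atTop
  have h2 := (h.tendsto_birthProd_rpow hs).comp (tendsto_add_atTop_nat 1)
  have h3 := (Real.continuous_exp.tendsto _).comp (h.tendsto_log_correction.const_mul s)
  have h4 := (h1.div h2 (h.growthConst_pos hs).ne').mul h3
  rw [mul_zero, Real.exp_zero, mul_one] at h4
  refine h4.congr fun m => ?_
  simp only [Pi.div_apply, Function.comp_apply]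
  have hm : (0 : ℝ) < ((m + 1 : ℕ) : ℝ) := by positivity
  have hrm := hr.cast_pos m
  have hA := birthProd_pos (isPeriodicThreshold_succ le_rfl).isRankThreshold hs (r m)
  have hP : 0 < ∏ k ∈ Finset.Icc 1 m, (1 + (ν : ℝ) / q * s * (delta r k / r k)) :=
    Finset.prod_pos fun k _ => one_add_mul_delta_pos hr hs k
  have e : Real.exp (s * (((ν : ℝ) / q - 1) * Real.eulerMascheroniConstant
        - (ν : ℝ) / q * rho r ((ν : ℝ) / q) - (ν : ℝ) / q
        + (ν : ℝ) / q * ∑ k ∈ Finset.Icc 1 m, delta r k / r k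
        + (ν : ℝ) / q * Real.log (r m) - Real.log (m + 1))) =
      Real.exp (s * (((ν : ℝ) / q - 1) * Real.eulerMascheroniConstant
        - (ν : ℝ) / q * rho r ((ν : ℝ) / q) - (ν : ℝ) / q)) *
      Real.exp ((ν : ℝ) / q * s * ∑ k ∈ Finset.Icc 1 m, delta r k / r k) *
      (r m : ℝ) ^ ((ν : ℝ) / q * s) / ((m + 1 : ℕ) : ℝ) ^ s := by
    rw [Real.rpow_def_of_pos hrm, Real.rpow_def_of_pos hm, ← Real.exp_add, ← Real.exp_add,
      ← Real.exp_sub]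
    push_cast
    ring_nf
  rw [e, birthProd_eq_mul hr]
  have h5 := Real.rpow_pos_of_pos hm s
  have h6 := Real.rpow_pos_of_pos hrm ((ν : ℝ) / q * s)
  generalize (ν : ℝ) / q * s = t at *
  generalize birthProd (fun k => k + 1) t (r m) = a at *
  generalize ∏ k ∈ Finset.Icc 1 m, (1 + t * (delta r k / r k)) = p at *
  field_simp

end IsPeriodicThreshold

/-! ### The random series `Z` -/

section Series

lemma partialZ_eq_sum {Ω : Type*} (r : ℕ → ℕ) (E : ℕ → Ω → ℝ) (m : ℕ) :
    (fun ω => partialZ r (fun k => E k ω) m) =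
    ∑ k ∈ Finset.Icc 1 m, fun ω => delta r k / r k * (E k ω - 1) := by
  funext ω
  simp [partialZ]

variable {Ω : Type*} [MeasurableSpace Ω] {P : Measure Ω}
  {E : ℕ → Ω → ℝ} {r : ℕ → ℕ} {q ν : ℕ}

lemma integrable_exp_summand (hEmeas : ∀ k, Measurable (E k))
    (hElaw : ∀ k, P.map (E k) = expMeasure 1) (hr : IsRankThreshold r) {t : ℝ} (ht : -1 < t)
    (k : ℕ) : Integrable (fun ω => Real.exp (-t * (delta r k / r k * (E k ω - 1)))) P := by
  have h1 := one_add_mul_delta_pos hr ht k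
  have h2 := (integrable_exp_mul_expMeasure_one (a := -t * (delta r k / r k)) (by linarith))
  rw [← hElaw k, integrable_map_measure (by fun_prop) (hEmeas k).aemeasurable] at h2
  refine (h2.const_mul (Real.exp (t * (delta r k / r k)))).congr (ae_of_all _ fun ω => ?_)
  simp only [Function.comp_apply, ← Real.exp_add]
  ring_nf

lemma mgf_summand (hEmeas : ∀ k, Measurable (E k))
    (hElaw : ∀ k, P.map (E k) = expMeasure 1) (hr : IsRankThreshold r) {t : ℝ} (ht : -1 < t)
    (k : ℕ) : mgf (fun ω => delta r k / r k * (E k ω - 1)) P (-t) =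
      Real.exp (t * (delta r k / r k)) / (1 + t * (delta r k / r k)) := by
  have h1 := one_add_mul_delta_pos hr ht k
  have h2 := (integral_exp_mul_expMeasure_one (a := -t * (delta r k / r k)) (by linarith))
  rw [← hElaw k, integral_map (hEmeas k).aemeasurable (by fun_prop)] at h2
  have e : ∀ ω, Real.exp (-t * (delta r k / r k * (E k ω - 1))) =
      Real.exp (t * (delta r k / r k)) * Real.exp (-t * (delta r k / r k) * E k ω) := fun ω => by
    rw [← Real.exp_add]
    ring_nf
  simp only [mgf, e]
  rw [integral_const_mul, h2]
  ring

lemma iIndepFun_summand (hEind : iIndepFun E P) :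
    iIndepFun (fun k ω => delta r k / r k * (E k ω - 1)) P :=
  hEind.comp (fun k x => delta r k / r k * (x - 1)) fun k => by fun_prop

lemma measurable_partialZ (hEmeas : ∀ k, Measurable (E k)) (m : ℕ) :
    Measurable (fun ω => partialZ r (fun k => E k ω) m) :=
  Finset.measurable_fun_sum _ fun k _ => ((hEmeas k).sub_const 1).const_mul _

lemma integrable_exp_partialZ [IsProbabilityMeasure P] (hEmeas : ∀ k, Measurable (E k))
    (hEind : iIndepFun E P)
    (hElaw : ∀ k, P.map (E k) = expMeasure 1) (hr : IsRankThreshold r) {t : ℝ} (ht : -1 < t)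
    (m : ℕ) : Integrable (fun ω => Real.exp (-t * partialZ r (fun k => E k ω) m)) P := by
  have := (iIndepFun_summand (r := r) hEind).integrable_exp_mul_sum
    (fun k => ((hEmeas k).sub_const 1).const_mul _) (s := Finset.Icc 1 m)
    fun k _ => integrable_exp_summand hEmeas hElaw hr ht k
  rwa [← partialZ_eq_sum] at this

lemma integral_exp_partialZ [IsProbabilityMeasure P] (hEmeas : ∀ k, Measurable (E k))
    (hEind : iIndepFun E P)
    (hElaw : ∀ k, P.map (E k) = expMeasure 1) (hr : IsRankThreshold r) {t : ℝ} (ht : -1 < t)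
    (m : ℕ) : ∫ ω, Real.exp (-t * partialZ r (fun k => E k ω) m) ∂P =
      Real.exp (t * ∑ k ∈ Finset.Icc 1 m, delta r k / r k) /
        ∏ k ∈ Finset.Icc 1 m, (1 + t * (delta r k / r k)) := by
  have := (iIndepFun_summand (r := r) hEind).mgf_sum (t := -t)
    (fun k => ((hEmeas k).sub_const 1).const_mul _) (Finset.Icc 1 m)
  rw [← partialZ_eq_sum, Finset.prod_congr rfl fun k _ => mgf_summand hEmeas hElaw hr ht k,
    Finset.prod_div_distrib, ← Real.exp_sum, ← Finset.mul_sum] at this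
  exact this

lemma integrable_summand [IsProbabilityMeasure P] (hEmeas : ∀ k, Measurable (E k))
    (hElaw : ∀ k, P.map (E k) = expMeasure 1) (k : ℕ) :
    Integrable (fun ω => delta r k / r k * (E k ω - 1)) P := by
  have h1 := integrable_id_expMeasure_one
  rw [← hElaw k, integrable_map_measure (by fun_prop) (hEmeas k).aemeasurable] at h1
  exact (h1.sub (integrable_const 1)).const_mul _

lemma integral_summand [IsProbabilityMeasure P] (hEmeas : ∀ k, Measurable (E k))
    (hElaw : ∀ k, P.map (E k) = expMeasure 1) (k : ℕ) :
    ∫ ω, delta r k / r k * (E k ω - 1) ∂P = 0 := by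
  have h1 := integrable_id_expMeasure_one
  have h2 := integral_id_expMeasure_one
  rw [← hElaw k, integrable_map_measure (by fun_prop) (hEmeas k).aemeasurable] at h1
  rw [← hElaw k, integral_map (hEmeas k).aemeasurable (by fun_prop)] at h2
  rw [integral_const_mul, integral_sub (f := E k) h1 (integrable_const 1), h2]
  simp

lemma martingale_partialZ [IsProbabilityMeasure P] (hEmeas : ∀ k, Measurable (E k))
    (hEind : iIndepFun E P)
    (hElaw : ∀ k, P.map (E k) = expMeasure 1) :
    Martingale (fun m ω => partialZ r (fun k => E k ω) m)
      (Filtration.natural (fun k ω => delta r k / r k * (E k ω - 1))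
        fun k => (((hEmeas k).sub_const 1).const_mul _).stronglyMeasurable) P := by
  have hYm : ∀ k, StronglyMeasurable (fun ω => delta r k / r k * (E k ω - 1)) :=
    fun k => (((hEmeas k).sub_const 1).const_mul _).stronglyMeasurable
  have hadp := Filtration.stronglyAdapted_natural hYm
  have hadpZ : StronglyAdapted (Filtration.natural _ hYm)
      (fun m ω => partialZ r (fun k => E k ω) m) := fun m =>
    Finset.stronglyMeasurable_fun_sum _ fun k hk =>
      (hadp k).mono ((Filtration.natural _ hYm).mono (Finset.mem_Icc.1 hk).2)
  have hint : ∀ m, Integrable (fun ω => partialZ r (fun k => E k ω) m) P := fun m =>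
    integrable_finsetSum _ fun k _ => integrable_summand hEmeas hElaw k
  refine martingale_nat hadpZ hint fun m => ?_
  have e : (fun ω => partialZ r (fun k => E k ω) (m + 1)) =
      (fun ω => partialZ r (fun k => E k ω) m) +
        fun ω => delta r (m + 1) / r (m + 1) * (E (m + 1) ω - 1) := by
    funext ω
    exact Finset.sum_Icc_succ_top (by omega) _
  rw [e]
  have h1 := condExp_add (hint m) (integrable_summand (r := r) hEmeas hElaw (m + 1))
    (Filtration.natural _ hYm m)
  have h2 := (iIndepFun_summand (r := r) hEind).condExp_natural_ae_eq_of_lt hYm (Nat.lt_succ_self m)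
  have h3 := condExp_of_stronglyMeasurable ((Filtration.natural _ hYm).le m) (hadpZ m) (hint m)
  filter_upwards [h1, h2] with ω hω1 hω2
  rw [hω1, Pi.add_apply, h3, hω2, integral_summand hEmeas hElaw, add_zero]

lemma exists_integral_exp_partialZ_le [IsProbabilityMeasure P] (hEmeas : ∀ k, Measurable (E k))
    (hEind : iIndepFun E P)
    (hElaw : ∀ k, P.map (E k) = expMeasure 1) (h : IsPeriodicThreshold r q ν) {t : ℝ}
    (ht : -1 < t) : ∃ K, ∀ m, ∫ ω, Real.exp (-t * partialZ r (fun k => E k ω) m) ∂P ≤ K := by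
  have hq := h.q_pos
  have hν := h.nu_pos
  obtain ⟨s, rfl⟩ : ∃ s : ℝ, t = (ν : ℝ) / q * s := ⟨t * (q / ν), by field_simp⟩
  obtain ⟨K, hK⟩ := (h.tendsto_exp_div_prod ht).bddAbove_range
  refine ⟨K / Real.exp (s * (((ν : ℝ) / q - 1) * Real.eulerMascheroniConstant
        - (ν : ℝ) / q * rho r ((ν : ℝ) / q) - (ν : ℝ) / q)), fun m => ?_⟩
  rw [integral_exp_partialZ hEmeas hEind hElaw h.isRankThreshold ht,
    le_div_iff₀ (Real.exp_pos _), mul_comm]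
  exact hK ⟨m, rfl⟩

/-- The partial sums form a martingale, bounded in `L¹` because `|z| ≤ 2(e^(z/2) + e^(-z/2))` and
both exponential moments stay bounded. -/
theorem ae_tendsto_partialZ [IsProbabilityMeasure P] (hEmeas : ∀ k, Measurable (E k))
    (hEind : iIndepFun E P)
    (hElaw : ∀ k, P.map (E k) = expMeasure 1) (h : IsPeriodicThreshold r q ν) :
    ∀ᵐ ω ∂P, Tendsto (partialZ r (fun k => E k ω)) atTop (𝓝 (seriesZ r (fun k => E k ω))) := by
  have hM := martingale_partialZ (r := r) hEmeas hEind hElaw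
  obtain ⟨K₁, hK₁⟩ := exists_integral_exp_partialZ_le hEmeas hEind hElaw h
    (t := 1 / 2) (by norm_num)
  obtain ⟨K₂, hK₂⟩ := exists_integral_exp_partialZ_le hEmeas hEind hElaw h
    (t := -(1 / 2)) (by norm_num)
  have hi₁ := integrable_exp_partialZ hEmeas hEind hElaw h.isRankThreshold
    (t := 1 / 2) (by norm_num)
  have hi₂ := integrable_exp_partialZ hEmeas hEind hElaw h.isRankThreshold
    (t := -(1 / 2)) (by norm_num)
  have hb : ∀ m, eLpNorm (fun ω => partialZ r (fun k => E k ω) m) 1 P ≤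
      Real.toNNReal (2 * (K₁ + K₂)) := fun m => by
    have hint := hM.integrable m
    rw [eLpNorm_one_eq_lintegral_enorm, ← ofReal_integral_norm_eq_lintegral_enorm hint]
    refine ENNReal.ofReal_le_ofReal ?_
    calc _ ≤ ∫ ω, 2 * (Real.exp (-(1 / 2) * partialZ r (fun k => E k ω) m) +
          Real.exp (- -(1 / 2) * partialZ r (fun k => E k ω) m)) ∂P := by
          refine integral_mono hint.norm (((hi₁ m).add (hi₂ m)).const_mul 2) fun ω => ?_
          simp only
          generalize partialZ r (fun k => E k ω) m = z
          have h1 := Real.add_one_le_exp (-(1 / 2) * z)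
          have h2 := Real.add_one_le_exp (- -(1 / 2) * z)
          have h3 := Real.exp_pos (-(1 / 2) * z)
          have h4 := Real.exp_pos (- -(1 / 2) * z)
          rw [Real.norm_eq_abs, abs_le]
          constructor <;> linarith
      _ ≤ _ := by
          rw [integral_const_mul, integral_add (hi₁ m) (hi₂ m)]
          linarith [hK₁ m, hK₂ m]
  filter_upwards [hM.submartingale.ae_tendsto_limitProcess hb] with ω hω
  exact tendsto_nhds_limUnder ⟨_, hω⟩

lemma aemeasurable_limitW [IsProbabilityMeasure P] (hEmeas : ∀ k, Measurable (E k))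
    (hEind : iIndepFun E P)
    (hElaw : ∀ k, P.map (E k) = expMeasure 1) (h : IsPeriodicThreshold r q ν) (α : ℝ) :
    AEMeasurable (fun ω => limitW r α (fun k => E k ω)) P := by
  have hZ : AEMeasurable (fun ω => seriesZ r (fun k => E k ω)) P :=
    aemeasurable_of_tendsto_metrizable_ae atTop
      (fun m => (measurable_partialZ hEmeas m).aemeasurable)
      (ae_tendsto_partialZ hEmeas hEind hElaw h)
  exact ((Real.measurable_exp.comp_aemeasurable (hZ.const_mul (-α))).const_mul _)

theorem integral_limitW_rpow [IsProbabilityMeasure P] (hEmeas : ∀ k, Measurable (E k))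
    (hEind : iIndepFun E P)
    (hElaw : ∀ k, P.map (E k) = expMeasure 1) (h : IsPeriodicThreshold r q ν) {s : ℝ}
    (hs : -1 < (ν : ℝ) / q * (s * 2)) :
    Integrable (fun ω => limitW r ((ν : ℝ) / q) (fun k => E k ω) ^ s) P ∧
    ∫ ω, limitW r ((ν : ℝ) / q) (fun k => E k ω) ^ s ∂P =
      1 / Real.Gamma ((ν : ℝ) / q * s + 1) / growthConst r q ν ((ν : ℝ) / q * s) := by
  have hr := h.isRankThreshold
  have hs1 : -1 < (ν : ℝ) / q * s := by
    rw [← mul_assoc] at hs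
    linarith
  obtain ⟨K, hK⟩ := exists_integral_exp_partialZ_le hEmeas hEind hElaw h hs
  generalize hκ : ((ν : ℝ) / q - 1) * Real.eulerMascheroniConstant
        - (ν : ℝ) / q * rho r ((ν : ℝ) / q) - (ν : ℝ) / q = κ
  have hlim := h.tendsto_exp_div_prod hs1
  rw [hκ] at hlim
  have esq : ∀ m ω, (Real.exp (s * κ) *
      Real.exp (-((ν : ℝ) / q * s) * partialZ r (fun k => E k ω) m)) ^ 2 =
      Real.exp (s * κ) ^ 2 *
        Real.exp (-((ν : ℝ) / q * (s * 2)) * partialZ r (fun k => E k ω) m) := by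
    intro m ω
    rw [mul_pow]
    congr 1
    rw [← Real.exp_nat_mul]
    push_cast
    ring_nf
  have key := tendsto_integral_of_integral_sq_le (P := P)
    (Y := fun m ω => Real.exp (s * κ) *
      Real.exp (-((ν : ℝ) / q * s) * partialZ r (fun k => E k ω) m))
    (Z := fun ω => limitW r ((ν : ℝ) / q) (fun k => E k ω) ^ s)
    (K := Real.exp (s * κ) ^ 2 * K)
    (fun m => ((integrable_exp_partialZ hEmeas hEind hElaw hr hs1 m).const_mul
      _).aestronglyMeasurable) (fun m => ?_) (fun m => ?_) ?_
  · refine ⟨key.1, tendsto_nhds_unique key.2 (hlim.congr fun m => ?_)⟩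
    rw [integral_const_mul, integral_exp_partialZ hEmeas hEind hElaw hr hs1]
  · simp only [esq]
    exact (integrable_exp_partialZ hEmeas hEind hElaw hr hs m).const_mul _
  · simp only [esq]
    rw [integral_const_mul]
    exact mul_le_mul_of_nonneg_left (hK m) (sq_nonneg _)
  · filter_upwards [ae_tendsto_partialZ hEmeas hEind hElaw h] with ω hω
    have e : limitW r ((ν : ℝ) / q) (fun k => E k ω) ^ s = Real.exp (s * κ) *
        Real.exp (-((ν : ℝ) / q * s) * seriesZ r (fun k => E k ω)) := by
      rw [limitW, hκ, ← Real.exp_add, ← Real.exp_mul, ← Real.exp_add]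
      ring_nf
    rw [e]
    exact ((Real.continuous_exp.tendsto _).comp (hω.const_mul _)).const_mul _

end Series

/-! ### Laws with the same moment generating function near the origin -/

/-- Both complex moment generating functions are analytic on the strip `|Re z| < ε` and agree on its
real segment; by the identity theorem they agree on the imaginary axis, where they are the
characteristic functions. -/
lemma map_eq_map_of_mgf_eq {Ω Ω' : Type*} [MeasurableSpace Ω] [MeasurableSpace Ω']
    {P : Measure Ω} {P' : Measure Ω'} [IsProbabilityMeasure P] [IsProbabilityMeasure P']
    {X : Ω → ℝ} {Y : Ω' → ℝ} (hX : AEMeasurable X P) (hY : AEMeasurable Y P') {ε : ℝ}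
    (hε : 0 < ε) (hXi : ∀ t ∈ Set.Ioo (-ε) ε, Integrable (fun ω => Real.exp (t * X ω)) P)
    (hYi : ∀ t ∈ Set.Ioo (-ε) ε, Integrable (fun ω => Real.exp (t * Y ω)) P')
    (hXY : ∀ t ∈ Set.Ioo (-ε) ε, mgf X P t = mgf Y P' t) :
    P.map X = P'.map Y := by
  let S : Set ℂ := {z | z.re ∈ Set.Ioo (-ε) ε}
  have hX2 : AnalyticOnNhd ℂ (complexMGF X P) S := analyticOnNhd_complexMGF.mono fun z hz =>
    interior_maximal (fun t ht => hXi t ht) isOpen_Ioo hz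
  have hY2 : AnalyticOnNhd ℂ (complexMGF Y P') S := analyticOnNhd_complexMGF.mono fun z hz =>
    interior_maximal (fun t ht => hYi t ht) isOpen_Ioo hz
  have hS : IsPreconnected S :=
    ((convex_Ioo (-ε) ε).linear_preimage Complex.reLm).isPreconnected
  have h0 : (0 : ℂ) ∈ S := by
    show (0 : ℂ).re ∈ Set.Ioo (-ε) ε
    simpa using hε
  have hfreq : ∃ᶠ z in 𝓝[≠] (0 : ℂ), complexMGF X P z = complexMGF Y P' z := by
    have ht : Tendsto (fun x : ℝ => (x : ℂ)) (𝓝[≠] 0) (𝓝[≠] 0) := by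
      refine tendsto_nhdsWithin_iff.2 ⟨?_, ?_⟩
      · exact (Complex.continuous_ofReal.tendsto' 0 0 rfl).mono_left nhdsWithin_le_nhds
      · filter_upwards [self_mem_nhdsWithin] with x hx
        simpa using hx
    refine ht.frequently (Eventually.frequently ?_)
    filter_upwards [mem_nhdsWithin_of_mem_nhds (Ioo_mem_nhds (neg_lt_zero.2 hε) hε)] with x hx
    rw [complexMGF_ofReal, complexMGF_ofReal, hXY x hx]
  have heq := hX2.eqOn_of_preconnected_of_frequently_eq hY2 hS h0 hfreq
  have := Measure.isProbabilityMeasure_map hX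
  have := Measure.isProbabilityMeasure_map hY
  refine Measure.ext_of_charFun (funext fun t => ?_)
  rw [← complexMGF_mul_I hX, ← complexMGF_mul_I hY]
  refine heq ?_
  show ((t : ℂ) * Complex.I).re ∈ Set.Ioo (-ε) ε
  simpa using hε

/-- Moments of a positive variable are the moment generating function of its logarithm. -/
lemma map_eq_map_of_integral_rpow_eq {Ω Ω' : Type*} [MeasurableSpace Ω] [MeasurableSpace Ω']
    {P : Measure Ω} {P' : Measure Ω'} [IsProbabilityMeasure P] [IsProbabilityMeasure P']
    {X : Ω → ℝ} {Y : Ω' → ℝ} (hX : AEMeasurable X P) (hY : AEMeasurable Y P')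
    (hX0 : ∀ᵐ ω ∂P, 0 < X ω) (hY0 : ∀ᵐ ω ∂P', 0 < Y ω) {ε : ℝ}
    (hε : 0 < ε) (hXi : ∀ s ∈ Set.Ioo (-ε) ε, Integrable (fun ω => X ω ^ s) P)
    (hYi : ∀ s ∈ Set.Ioo (-ε) ε, Integrable (fun ω => Y ω ^ s) P')
    (hXY : ∀ s ∈ Set.Ioo (-ε) ε, ∫ ω, X ω ^ s ∂P = ∫ ω, Y ω ^ s ∂P') :
    P.map X = P'.map Y := by
  have hXe : ∀ s, (fun ω => Real.exp (s * Real.log (X ω))) =ᵐ[P] fun ω => X ω ^ s := fun s => by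
    filter_upwards [hX0] with ω hω
    rw [Real.rpow_def_of_pos hω, mul_comm]
  have hYe : ∀ s, (fun ω => Real.exp (s * Real.log (Y ω))) =ᵐ[P'] fun ω => Y ω ^ s := fun s => by
    filter_upwards [hY0] with ω hω
    rw [Real.rpow_def_of_pos hω, mul_comm]
  have hlX : AEMeasurable (fun ω => Real.log (X ω)) P := Real.measurable_log.comp_aemeasurable hX
  have hlY : AEMeasurable (fun ω => Real.log (Y ω)) P' := Real.measurable_log.comp_aemeasurable hY
  have key := map_eq_map_of_mgf_eq hlX hlY hε
    (fun s hs => (hXi s hs).congr (hXe s).symm) (fun s hs => (hYi s hs).congr (hYe s).symm)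
    fun s hs => by
      rw [mgf, mgf, integral_congr_ae (hXe s), integral_congr_ae (hYe s), hXY s hs]
  have h1 : P.map X = (P.map fun ω => Real.log (X ω)).map Real.exp := by
    rw [AEMeasurable.map_map_of_aemeasurable Real.measurable_exp.aemeasurable hlX]
    refine Measure.map_congr ?_
    filter_upwards [hX0] with ω hω
    exact (Real.exp_log hω).symm
  have h2 : P'.map Y = (P'.map fun ω => Real.log (Y ω)).map Real.exp := by
    rw [AEMeasurable.map_map_of_aemeasurable Real.measurable_exp.aemeasurable hlY]
    refine Measure.map_congr ?_
    filter_upwards [hY0] with ω hω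
    exact (Real.exp_log hω).symm
  rw [h1, h2, key]

end

end Hiring

namespace Hiring

/-! ### The moments of the limit -/

lemma IsPeriodicThreshold.moment_eq {r : ℕ → ℕ} {q ν : ℕ} (h : IsPeriodicThreshold r q ν) {s : ℝ}
    (hs : 0 ≤ s) :
    1 / Real.Gamma ((ν : ℝ) / q * s + 1) / growthConst r q ν ((ν : ℝ) / q * s) =
      (q : ℝ) ^ s / Real.Gamma (s * ((ν : ℝ) / q) + 2) *
        ∏ i ∈ Finset.Icc 1 q,
          Real.Gamma (s / q + (r i : ℝ) / ν) / Real.Gamma ((r i : ℝ) / ν) := by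
  have hq := h.q_pos
  have hν := h.nu_pos
  have e1 : (ν : ℝ) / q * s / ν = s / q := by field_simp
  have e2 : (ν : ℝ) / q * s * q / ν = s := by field_simp
  have e3 : s * ((ν : ℝ) / q) + 2 = ((ν : ℝ) / q * s + 1) + 1 := by ring
  have ht : 0 < (ν : ℝ) / q * s + 1 := by positivity
  have hP : ∏ i ∈ Finset.Icc 1 q,
      Real.Gamma (s / q + (r i : ℝ) / ν) / Real.Gamma ((r i : ℝ) / ν) =
      (∏ i ∈ Finset.Icc 1 q,
        Real.Gamma ((r i : ℝ) / ν) / Real.Gamma (s / q + (r i : ℝ) / ν))⁻¹ := by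
    rw [← Finset.prod_inv_distrib]
    exact Finset.prod_congr rfl fun i _ => (inv_div _ _).symm
  rw [growthConst, e1, e2, e3, Real.Gamma_add_one ht.ne', hP, add_comm 1]
  generalize ∏ i ∈ Finset.Icc 1 q,
    Real.Gamma ((r i : ℝ) / ν) / Real.Gamma (s / q + (r i : ℝ) / ν) = p
  simp only [div_eq_mul_inv, mul_inv, inv_inv]
  ring

end Hiring

/-! ### Assembly on the original probability spaces. -/

theorem mainTheorem7
    (r : ℕ → ℕ) (hr : Hiring.IsRankThreshold r)
    (q ν : ℕ) (hν : 1 ≤ ν) (hνq : ν ≤ q)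
    (hper : ∀ m : ℕ, 1 ≤ m → r (m + q) = r m + ν)
    (α : ℝ) (hα : α = (ν : ℝ) / (q : ℝ))
    -- the values of the candidates: i.i.d. with an arbitrary continuous distribution `μ`
    {Ω : Type*} [MeasurableSpace Ω] (P : Measure Ω) [IsProbabilityMeasure P]
    (μ : Measure ℝ) [NullSingletonClass μ]
    (X : ℕ → Ω → ℝ) (hXmeas : ∀ n, Measurable (X n)) (hXind : iIndepFun X P)
    (hXlaw : ∀ n, P.map (X n) = μ)
    -- the i.i.d. `Exp(1)` variables in the representation of `W`
    {Ω' : Type*} [MeasurableSpace Ω'] (P' : Measure Ω') [IsProbabilityMeasure P']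
    (E : ℕ → Ω' → ℝ) (hEmeas : ∀ k, Measurable (E k)) (hEind : iIndepFun E P')
    (hElaw : ∀ k, P'.map (E k) = expMeasure 1) :
    -- the series defining `Z` converges almost surely, and so does the one defining `ρ`
    (∀ᵐ ω' ∂P', Tendsto (Hiring.partialZ r (fun k => E k ω')) atTop
      (𝓝 (Hiring.seriesZ r (fun k => E k ω')))) ∧
    Summable (fun m : ℕ => 1 / (r (m + 1) : ℝ) - 1 / (α * ((m + 1 : ℕ) : ℝ))) ∧
    -- `W` is the almost sure limit of `M_n / n ^ α`, and has the stated representation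
    ∃ W : Ω → ℝ,
      (∀ᵐ ω ∂P, Tendsto
        (fun n : ℕ => (Hiring.numAccepted r (fun i => X i ω) n : ℝ) / (n : ℝ) ^ α) atTop
        (𝓝 (W ω))) ∧
      IdentDistrib W (fun ω' => Hiring.limitW r α (fun k => E k ω')) P P' ∧
      -- convergence and values of the moments
      ∀ s : ℝ, 0 ≤ s →
        (∀ n : ℕ, Integrable (fun ω => (Hiring.numAccepted r (fun i => X i ω) n : ℝ) ^ s) P) ∧
        Integrable (fun ω => W ω ^ s) P ∧
        Tendsto
          (fun n : ℕ => (∫ ω, (Hiring.numAccepted r (fun i => X i ω) n : ℝ) ^ s ∂P) /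
            (n : ℝ) ^ (α * s)) atTop
          (𝓝 (∫ ω, W ω ^ s ∂P)) ∧
        (∫ ω, W ω ^ s ∂P) =
          Real.Gamma (s + 1) / Real.Gamma (s * α + 2) *
            ∏ i ∈ Finset.Icc 1 q,
              (Real.Gamma ((i : ℝ) / q) * Real.Gamma (s / q + (r i : ℝ) / ν)) /
                (Real.Gamma ((r i : ℝ) / ν) * Real.Gamma (s / q + (i : ℝ) / q)) ∧
        (∫ ω, W ω ^ s ∂P) =
          (q : ℝ) ^ s / Real.Gamma (s * α + 2) *
            ∏ i ∈ Finset.Icc 1 q,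
              Real.Gamma (s / q + (r i : ℝ) / ν) / Real.Gamma ((r i : ℝ) / ν) ∧
        (∫ ω, W ω ^ s ∂P) =
          (q : ℝ) ^ s / (ν : ℝ) ^ (α * s) *
            (∏ i ∈ Finset.Icc 1 q,
              Real.Gamma (s / q + (r i : ℝ) / ν) / Real.Gamma ((r i : ℝ) / ν)) *
            ∏ j ∈ Finset.Icc 2 (ν + 1),
              Real.Gamma ((j : ℝ) / ν) / Real.Gamma (s / q + (j : ℝ) / ν) ∧
        (∫ ω, W ω ^ s ∂P) =
          (q : ℝ) ^ (s + 1) / ((ν : ℝ) ^ (α * s) * (ν * s + q)) *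
            (∏ i ∈ Finset.Icc 1 q,
              Real.Gamma (s / q + (r i : ℝ) / ν) / Real.Gamma ((r i : ℝ) / ν)) *
            ∏ j ∈ Finset.Icc 1 ν,
              Real.Gamma ((j : ℝ) / ν) / Real.Gamma (s / q + (j : ℝ) / ν) := by
  subst hα
  have h : Hiring.IsPeriodicThreshold r q ν := ⟨hr, hν, hνq, hper⟩
  have hq := h.q_pos
  have hν' := h.nu_pos
  have hq1 : 1 ≤ q := hν.trans hνq
  have hα : 0 < (ν : ℝ) / q := div_pos hν' hq
  have hXm : Measurable (fun ω i => X i ω) := measurable_pi_iff.2 hXmeas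
  have hQ := Hiring.isExchangeableLaw_map hXmeas hXind hXlaw
  have hQp : IsProbabilityMeasure (P.map (fun ω i => X i ω)) :=
    Measure.isProbabilityMeasure_map hXm.aemeasurable
  obtain ⟨G, hGm, hG⟩ := hQ.exists_tendsto_birthProd hr
  let W : (ℕ → ℝ) → ℝ := fun x => (G x / Hiring.growthConst r q ν 1) ^ ((ν : ℝ) / q)
  have hWm : Measurable W := (hGm.div_const _).pow_const _
  have hW : ∀ᵐ x ∂(P.map (fun ω i => X i ω)), Tendsto (fun n : ℕ =>
      (Hiring.numAccepted r x n : ℝ) / (n : ℝ) ^ ((ν : ℝ) / q)) atTop (𝓝 (W x)) := by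
    filter_upwards [hG] with x hx
    exact h.tendsto_numAccepted_div hx
  refine ⟨Hiring.ae_tendsto_partialZ hEmeas hEind hElaw h, h.summable_inv_sub,
    fun ω => W (fun i => X i ω), ae_of_ae_map hXm.aemeasurable hW, ?_, fun s hs => ?_⟩
  -- The radius `1/(2α)` keeps the doubled parameter `2αs` above `-1`.
  · have hε : 0 < (q : ℝ) / ν / 2 := by positivity
    have hss : ∀ s ∈ Set.Ioo (-((q : ℝ) / ν / 2)) ((q : ℝ) / ν / 2),
        -1 < (ν : ℝ) / q * (s * 2) := fun s hs => by
      have h1 := mul_lt_mul_of_pos_left hs.1 hα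
      have h2 : (ν : ℝ) / q * -((q : ℝ) / ν / 2) = -(1 / 2) := by field_simp
      linarith
    refine ⟨(hWm.comp hXm).aemeasurable, Hiring.aemeasurable_limitW hEmeas hEind hElaw h _, ?_⟩
    have key := Hiring.map_eq_map_of_integral_rpow_eq (P := P.map (fun ω i => X i ω)) (P' := P')
      hWm.aemeasurable (Hiring.aemeasurable_limitW hEmeas hEind hElaw h ((ν : ℝ) / q))
      (hQ.ae_pos_of_tendsto h hW)
      (ae_of_all _ fun ω => mul_pos (Real.exp_pos _) (Real.exp_pos _)) hε
      (fun s hs => (hQ.tendsto_moment h hW (hss s hs)).1)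
      (fun s hs => (Hiring.integral_limitW_rpow hEmeas hEind hElaw h (hss s hs)).1)
      fun s hs => by
        rw [hQ.integral_limit_rpow h hW (hss s hs),
          (Hiring.integral_limitW_rpow hEmeas hEind hElaw h (hss s hs)).2]
    rw [← key, Measure.map_map hWm hXm]
    rfl
  · have hs2 : -1 < (ν : ℝ) / q * (s * 2) :=
      lt_of_lt_of_le (by norm_num) (by positivity : 0 ≤ (ν : ℝ) / q * (s * 2))
    obtain ⟨hint, hlim⟩ := hQ.tendsto_moment h hW hs2
    have hval := hQ.integral_limit_rpow h hW hs2
    have hMm : ∀ n, Measurable fun x : ℕ → ℝ => (Hiring.numAccepted r x n : ℝ) ^ s := fun n =>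
      (measurable_from_nat (f := fun m : ℕ => (m : ℝ) ^ s)).comp
        (Hiring.measurable_numAccepted hr n)
    have hWs : Measurable fun x => W x ^ s := hWm.pow_const s
    rw [integral_map hXm.aemeasurable hWs.aestronglyMeasurable] at hval hlim
    have hlim' := hlim.congr fun n => by
      rw [integral_map hXm.aemeasurable (hMm n).aestronglyMeasurable]
    have hB := hval.trans (h.moment_eq hs)
    -- The multiplication formula with `N = ν` and `t = αs` replaces `1/Γ(αs+2)` by a product;
    -- below, `N = q` and `t = s` does the same for `Γ(s+1)`.
    have hprod : ∏ j ∈ Finset.Icc 2 (ν + 1),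
        Real.Gamma ((j : ℝ) / ν) / Real.Gamma (s / q + (j : ℝ) / ν) =
        (ν : ℝ) ^ ((ν : ℝ) / q * s) / Real.Gamma (s * ((ν : ℝ) / q) + 2) := by
      rw [mul_comm s]
      have := Hiring.prod_Gamma_div_Gamma hν (t := (ν : ℝ) / q * s)
        (lt_of_lt_of_le (by norm_num) (by positivity : 0 ≤ (ν : ℝ) / q * s))
      rwa [(by field_simp : (ν : ℝ) / q * s / ν = s / q)] at this
    have hprod1 : ∏ j ∈ Finset.Icc 1 ν,
        Real.Gamma ((j : ℝ) / ν) / Real.Gamma (s / q + (j : ℝ) / ν) =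
        (ν : ℝ) ^ ((ν : ℝ) / q * s) * ((ν : ℝ) / q * s + 1) /
          Real.Gamma (s * ((ν : ℝ) / q) + 2) := by
      have hu : 0 < (ν : ℝ) / q * s + 1 := by positivity
      have := Hiring.prod_Gamma_div_Gamma_one hν (t := (ν : ℝ) / q * s) (by linarith)
      rw [(by field_simp : (ν : ℝ) / q * s / ν = s / q)] at this
      rw [this, (by ring : s * ((ν : ℝ) / q) + 2 = ((ν : ℝ) / q * s + 1) + 1),
        Real.Gamma_add_one hu.ne']
      have hG := (Real.Gamma_pos_of_pos hu).ne'
      generalize (ν : ℝ) / q * s + 1 = u at *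
      have hu' := hu.ne'
      field_simp
    have hprodq : ∏ i ∈ Finset.Icc 1 q,
        Real.Gamma ((i : ℝ) / q) / Real.Gamma (s / q + (i : ℝ) / q) =
        (q : ℝ) ^ s / Real.Gamma (s + 1) :=
      Hiring.prod_Gamma_div_Gamma_one hq1 (by linarith)
    have hG1 := (Real.Gamma_pos_of_pos (by linarith : 0 < s + 1)).ne'
    have hG2 := (Real.Gamma_pos_of_pos (by positivity : 0 < s * ((ν : ℝ) / q) + 2)).ne'
    have hνp := (Real.rpow_pos_of_pos hν' ((ν : ℝ) / q * s)).ne'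
    refine ⟨fun n => ?_, ?_, hlim', ?_, hB, ?_, ?_⟩
    · have := Hiring.IsExchangeableLaw.integrable_comp_numAccepted
        (Q := P.map (fun ω i => X i ω)) hr (fun m => (m : ℝ) ^ s) n
      exact this.comp_measurable hXm
    · exact hint.comp_measurable hXm
    · rw [hB]
      have e : ∀ i : ℕ, Real.Gamma ((i : ℝ) / q) * Real.Gamma (s / q + (r i : ℝ) / ν) /
          (Real.Gamma ((r i : ℝ) / ν) * Real.Gamma (s / q + (i : ℝ) / q)) =
          Real.Gamma ((i : ℝ) / q) / Real.Gamma (s / q + (i : ℝ) / q) *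
          (Real.Gamma (s / q + (r i : ℝ) / ν) / Real.Gamma ((r i : ℝ) / ν)) := fun i => by
        rw [div_mul_div_comm, mul_comm (Real.Gamma (s / q + (i : ℝ) / q))]
      simp only [e]
      rw [Finset.prod_mul_distrib, hprodq]
      field_simp
    · rw [hB, hprod]
      field_simp
    · rw [hB, hprod1, Real.rpow_add hq, Real.rpow_one]
      generalize Real.Gamma (s * ((ν : ℝ) / q) + 2) = g at *
      generalize (ν : ℝ) ^ ((ν : ℝ) / q * s) = v at *
      have : (ν : ℝ) * s + q ≠ 0 := by positivity
      field_simp
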